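/- Let $\mathcal U$ be a set of $N$ users and $\mathcal P$ a set of $L$ providers, $N\ge L\ge 1$, $\mathcal A=\mathcal U\cup\mathcal P$; write $\emptyset$ for "no partner", and let $a'$ always range over the agents on the other side of the market from $a$, and possibly $\emptyset$. The unknown true preferences are $\mu(a,a')\ge 0$, with $\mu(a,\emptyset)=0$ and no ties: $\mu(a,a')\ne\mu(a,a'')$ for $a'\ne a''$ ($\emptyset$ included). At time $t=1,2,\dots$ an agent $a$ matched to $a'$ receives a reward $X_t(a,a')$ drawn from a $\sigma^2$-sub-Gaussian law $\mathcal D(a,a')$ with mean $\mu(a,a')$ ($\sigma>0$); in addition $a$ starts with $T_0(a,a')=T_0(a',a)>0$ samples from $\mathcal D(a,a')$; all samples are independent; $X_t(a,\emptyset)=0$. Let $\nu_t(a,a')=\hat\mu_t(a,a')+\sqrt{2\sigma^2\alpha\log t/T_{t-1}(a,a')}$ with $\alpha>2$, where $T_{t-1}(a,a')$ is the number of samples that $a$ has of $a'$ up to time $t-1$ and $\hat\mu_t(a,a')$ is their mean; $\nu_t(a,\emptyset)=0$. For constants $c_1,c_2\in\mathbb R$ and a pricing rule $g(p;\psi)$,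 the payoffs under preferences $\psi$ are $V(p,u;\psi)=\psi(p,u)-c_1+g(p;\psi)$, $V(u,p;\psi)=\psi(u,p)-c_2-g(p;\psi)$ and $V(a,\emptyset;\psi)=\psi(a,\emptyset)$, and the observed payoffs are $U_t(p,u)=X_t(p,u)-c_1+g(p;\nu_t)$, $U_t(u,p)=X_t(u,p)-c_2-g(p;\nu_t)$, $U_t(a,\emptyset)=0$. A matching gives each provider exactly one user and each user at most one provider; it is stable under $V$ if no user and provider would both strictly gain in $V$ by leaving it to pair off together; $S(V)$ is the set of stable matchings. At each time $t$ the platform uses a matching $\mathcal M_t=\mathcal M(\cdot;\nu_t)$ returned by the Gale–Shapley algorithm, with providers proposing and ties broken in any way, on the payoffs $V(\cdot,\cdot;\nu_t)$ (a provider goes down its list of all users, and a user without a match accepts any proposal). The optimal [pessimal] regret of $a$ over the horizon $T$ is $\bar R(a)=\mathbb E\sum_{t=1}^T\big(U_t(a,M_t(a))-U_t(a,\mathcal M_t(a))\big)$ [$\underline R(a)$], where $M_t\in S(V(\cdot,\cdot;\mu))$ maximizes [minimizes] $\mathbb E[U_t(a,M(a))]$ over $M\in S(V(\cdot,\cdot;\mu))$.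 The mechanism is unfair if some agent has $\bar R(a)=O(\log T)$ (as an upper bound) while another has $\bar R(a')=\omega(\log T)$, and fair otherwise. Theorem. (1) For all $c_1,c_2,g$ the system is incentive-compatible: $\mathcal M_t\in S(V(\cdot,\cdot;\nu_t))$ for all $t\ge 1$. (2) Suppose $|\mu(u,\cdot)|\le B$ for all $u\in\mathcal U$, where $B>0$. Then there exist constants $c_1,c_2$ and a pricing rule $g$, namely, for any ordering $p_1,\dots,p_L$ of the providers, $c_1=0$, $c_2=2B(1-L)$ and $g(p_k;\psi)=2B(L-k)$, such that $S(V(\cdot,\cdot;\mu))$ consists of a single matching $M^*$, for all $a\in\mathcal A$ and $T\ge 1$ $$\underline R(a)=\bar R(a)\le 2\,\Delta^*_{\max}(a)\,N^2L\left(\frac{8\sigma^2\alpha\log T}{\Delta_{\min}^2}+\frac{\alpha}{\alpha-2}\right),$$ and the mechanism is fair. Here $\Delta_{\min}=\min_{a}\min_{a'\neq a''}|\mu(a,a')-\mu(a,a'')|$ and $\Delta^*_{\max}(a)=2B(L-1)\mathbf 1(a\in\mathcal U)+\max_{a'}\big(\mu(a,M^*(a))-\mu(a,a')\big)$, where $a',a''$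 may be $\emptyset$. -/

import Mathlib

open MeasureTheory ProbabilityTheory Filter

namespace MatchingBandits

/-- The agents of a market with `N` users (left summand) and `L` providers (right summand). -/
abbrev Agent (N L : ℕ) : Type := Fin N ⊕ Fin L

/-- The agents on the opposite side of the market: providers for a user, users for a provider.
`Option (Partner a)` adds `none`, which stands for being unmatched. -/
abbrev Partner {N L : ℕ} : Agent N L → Type
  | .inl _ => Fin L
  | .inr _ => Fin N

instance {N L : ℕ} : (a : Agent N L) → Fintype (Partner a)
  | .inl _ => inferInstanceAs (Fintype (Fin L))
  | .inr _ => inferInstanceAs (Fintype (Fin N))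

instance {N L : ℕ} : (a : Agent N L) → DecidableEq (Partner a)
  | .inl _ => inferInstanceAs (DecidableEq (Fin L))
  | .inr _ => inferInstanceAs (DecidableEq (Fin N))

/-- Real functions of an agent and a (possibly absent) partner: preferences `ψ`, payoffs `V`. -/
abbrev Pref (N L : ℕ) : Type := (a : Agent N L) → Option (Partner a) → ℝ

/-- A map sending every agent to its match, or to `none` if it is unmatched. -/
abbrev Assignment (N L : ℕ) : Type := (a : Agent N L) → Option (Partner a)

/-- The feasible matchings `𝒲`: matched agents are matched to each other (so that each user has at
most one provider), and every provider is matched to a user. -/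
def IsFeasible {N L : ℕ} (M : Assignment N L) : Prop :=
  (∀ (u : Fin N) (p : Fin L), M (.inl u) = some p ↔ M (.inr p) = some u) ∧
    ∀ p : Fin L, M (.inr p) ≠ none

/-- `M` is a stable matching under the payoffs `V`: no user and provider both gain strictly by
leaving `M` and pairing off together. -/
def IsStable {N L : ℕ} (V : Pref N L) (M : Assignment N L) : Prop :=
  IsFeasible M ∧
    ¬ ∃ (u : Fin N) (p : Fin L),
      V (.inl u) (M (.inl u)) < V (.inl u) (some p) ∧
      V (.inr p) (M (.inr p)) < V (.inr p) (some u)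

/-- The set `S(V)` of stable matchings. -/
def stableSet {N L : ℕ} (V : Pref N L) : Set (Assignment N L) := {M | IsStable V M}

/-! ### The Gale-Shapley algorithm with providers as proposers -/

/-- The state of the algorithm: current tentative matching and the providers' queues. -/
structure GSState (N L : ℕ) where
  matching : Assignment N L
  queue : Fin L → List (Fin N)

/-- The queue `l` of provider `p` lists every user once, in order of decreasing payoff for `p`. -/
def IsPreferenceList {N L : ℕ} (V : Pref N L) (p : Fin L) (l : List (Fin N)) : Prop :=
  l.Nodup ∧ (∀ u, u ∈ l) ∧ l.Pairwise (fun u u' => V (.inr p) (some u') ≤ V (.inr p) (some u))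

/-- One pass through the loop: some unmatched provider `p` pops the next user `u` of its queue and
proposes. An unmatched user accepts; a matched user accepts if and only if it strictly prefers
`p` to its current match, which then becomes unmatched. -/
inductive GSStep {N L : ℕ} (V : Pref N L) : GSState N L → GSState N L → Prop
  | accept (s : GSState N L) (p : Fin L) (u : Fin N) (q : List (Fin N))
      (hp : s.matching (.inr p) = none) (hq : s.queue p = u :: q)
      (hu : s.matching (.inl u) = none) :
      GSStep V s
        ⟨Function.update (Function.update s.matching (.inl u) (some p)) (.inr p) (some u),
          Function.update s.queue p q⟩
  | swap (s : GSState N L) (p p' : Fin L) (u : Fin N) (q : List (Fin N))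
      (hp : s.matching (.inr p) = none) (hq : s.queue p = u :: q)
      (hu : s.matching (.inl u) = some p')
      (hlt : V (.inl u) (some p') < V (.inl u) (some p)) :
      GSStep V s
        ⟨Function.update (Function.update (Function.update s.matching (.inr p') none)
            (.inl u) (some p)) (.inr p) (some u),
          Function.update s.queue p q⟩
  | reject (s : GSState N L) (p p' : Fin L) (u : Fin N) (q : List (Fin N))
      (hp : s.matching (.inr p) = none) (hq : s.queue p = u :: q)
      (hu : s.matching (.inl u) = some p')
      (hle : V (.inl u) (some p) ≤ V (.inl u) (some p')) :
      GSStep V s ⟨s.matching, Function.update s.queue p q⟩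

/-- `M` is a matching returned by the algorithm on the payoffs `V`, for some order in which ties in
the queues are broken and some choice of the proposing provider in each pass: it is reached
from the empty matching with full queues, and no provider is unmatched. -/
def IsGSOutput {N L : ℕ} (V : Pref N L) (M : Assignment N L) : Prop :=
  ∃ Q₀ Q : Fin L → List (Fin N),
    (∀ p, IsPreferenceList V p (Q₀ p)) ∧
    Relation.ReflTransGen (GSStep V) ⟨fun _ => none, Q₀⟩ ⟨M, Q⟩ ∧
    ∀ p : Fin L, M (.inr p) ≠ none

/-! ### Cost and transfer rules -/

/-- A cost rule `𝒞(a, a'; ψ)` together with a transfer rule `𝒯(a, a'; ψ)`. -/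
structure Rules (N L : ℕ) where
  cost : Pref N L → Pref N L
  transfer : Pref N L → Pref N L
  cost_none : ∀ ψ a, cost ψ a none = 0
  transfer_none : ∀ ψ a, transfer ψ a none = 0
  transfer_antisymm : ∀ ψ (u : Fin N) (p : Fin L),
    transfer ψ (.inl u) (some p) = - transfer ψ (.inr p) (some u)

/-- The payoff `V(a, a'; ψ) = ψ(a, a') - 𝒞(a, a'; ψ) + 𝒯(a, a'; ψ)`. -/
def Rules.payoff {N L : ℕ} (R : Rules N L) (ψ : Pref N L) : Pref N L :=
  fun a b => ψ a b - R.cost ψ a b + R.transfer ψ a b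

/-- Constant costs: `c₁` for a matched provider, `c₂` for a matched user. -/
def constantCost {N L : ℕ} (c₁ c₂ : ℝ) : (a : Agent N L) → Option (Partner a) → ℝ
  | _, none => 0
  | .inl _, some _ => c₂
  | .inr _, some _ => c₁

/-- Prices: a matched user pays the price `g p` to its provider `p`. -/
def priceTransfer {N L : ℕ} (g : Fin L → ℝ) : (a : Agent N L) → Option (Partner a) → ℝ
  | _, none => 0
  | .inl _, some p => - g p
  | .inr p, some _ => g p

/-- The pricing setting: constant costs `c₁`, `c₂`, and market prices `g(p; ψ)`. -/
def pricingRules {N L : ℕ} (c₁ c₂ : ℝ) (g : Fin L → Pref N L → ℝ) : Rules N L where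
  cost _ := constantCost c₁ c₂
  transfer ψ := priceTransfer (fun p => g p ψ)
  cost_none _ a := by cases a <;> rfl
  transfer_none _ a := by cases a <;> rfl
  transfer_antisymm _ _ _ := rfl

/-! ### Markets with bandit learners -/

/-- Index set of all noisy samples: the reward at time `t` of `a` for `a'`, and the
`T₀ a a'` initial samples that `a` has of `a'`. -/
abbrev SampleIndex {N L : ℕ} (T₀ : (a : Agent N L) → Partner a → ℕ) : Type :=
  (ℕ × Σ a : Agent N L, Partner a) ⊕ (Σ x : Σ a : Agent N L, Partner a, Fin (T₀ x.1 x.2))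

/-- A two-sided market with `N ≥ L ≥ 1`, true preferences `pref` (written `μ` in the comments),
reward distributions `D a a'` that are sub-Gaussian with parameter `σ²` and centered at `μ(a, a')`,
`T₀ a a' > 0` initial samples, rewards `X t a a'` at the times `t = 1, 2, …`
(`X 0` is never used), and confidence parameter `α > 2`. -/
structure Market (N L : ℕ) {Ω : Type*} [MeasurableSpace Ω] (P : Measure Ω) where
  one_le_L : 1 ≤ L
  L_le_N : L ≤ N
  /-- the true preferences -/
  pref : Pref N L
  pref_nonneg : ∀ a b, 0 ≤ pref a b
  pref_none : ∀ a, pref a none = 0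
  /-- there are no ties -/
  pref_injective : ∀ a, Function.Injective (pref a)
  σ : ℝ
  σ_pos : 0 < σ
  α : ℝ
  two_lt_α : 2 < α
  /-- the reward distributions -/
  D : (a : Agent N L) → Partner a → Measure ℝ
  D_mean : ∀ a b, ∫ x, x ∂(D a b) = pref a (some b)
  D_subgaussian : ∀ a b,
    HasSubgaussianMGF (fun x => x - pref a (some b)) (Real.toNNReal (σ ^ 2)) (D a b)
  /-- the numbers of initial samples -/
  T₀ : (a : Agent N L) → Partner a → ℕ
  T₀_pos : ∀ a b, 0 < T₀ a b
  T₀_symm : ∀ (u : Fin N) (p : Fin L), T₀ (.inl u) p = T₀ (.inr p) u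
  /-- the initial samples -/
  X₀ : (a : Agent N L) → (b : Partner a) → Fin (T₀ a b) → Ω → ℝ
  /-- the rewards -/
  X : ℕ → (a : Agent N L) → Partner a → Ω → ℝ
  X₀_measurable : ∀ a b i, Measurable (X₀ a b i)
  X_measurable : ∀ t a b, Measurable (X t a b)
  X₀_law : ∀ a b i, P.map (X₀ a b i) = D a b
  X_law : ∀ t a b, P.map (X t a b) = D a b
  /-- all samples are mutually independent -/
  indep : iIndepFun
    (fun i : SampleIndex T₀ => Sum.elim (fun x : ℕ × Σ a : Agent N L, Partner a => X x.1 x.2.1 x.2.2)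
      (fun y : Σ x : Σ a : Agent N L, Partner a, Fin (T₀ x.1 x.2) => X₀ y.1.1 y.1.2 y.2) i) P

/-- What the agents have learned: how often each agent has sampled each partner, and the sum of
these samples. -/
structure Samples (N L : ℕ) where
  count : (a : Agent N L) → Partner a → ℕ
  total : (a : Agent N L) → Partner a → ℝ

namespace Market

variable {N L : ℕ} {Ω : Type*} [MeasurableSpace Ω] {P : Measure Ω}

/-- The upper confidence bounds at time `t` computed from the samples `s`; the quotient
`s.total a b / s.count a b` is the empirical mean. -/
noncomputable def ucb (m : Market N L P) (t : ℕ) (s : Samples N L) : Pref N L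
  | _, none => 0
  | a, some b => s.total a b / s.count a b
      + Real.sqrt (2 * m.σ ^ 2 * m.α * Real.log t / s.count a b)

/-- The samples up to and including time `t` when the platform matches by `𝓜`:
`count` is `T_t(a, a') = T₀(a, a') + ∑_{τ ≤ t} 1(𝓜(a; ν_τ) = a')`, and `total` is the sum of
these samples. -/
noncomputable def samples (m : Market N L P) (𝓜 : Pref N L → Assignment N L) (ω : Ω) :
    ℕ → Samples N L
  | 0 => ⟨m.T₀, fun a b => ∑ i, m.X₀ a b i ω⟩
  | t + 1 =>
      let s := samples m 𝓜 ω t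
      let M := 𝓜 (m.ucb (t + 1) s)
      ⟨fun a b => s.count a b + if M a = some b then 1 else 0,
        fun a b => s.total a b + if M a = some b then m.X (t + 1) a b ω else 0⟩

/-- The transient preferences `ν_t` (for `t ≥ 1`): upper confidence bounds computed from the samples
up to time `t - 1`. -/
noncomputable def transient (m : Market N L P) (𝓜 : Pref N L → Assignment N L) (t : ℕ) (ω : Ω) :
    Pref N L :=
  m.ucb t (m.samples 𝓜 ω (t - 1))

/-- The matching `𝓜(·; ν_t)` at time `t`. -/
noncomputable def matchAt (m : Market N L P) (𝓜 : Pref N L → Assignment N L) (t : ℕ) (ω : Ω) :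
    Assignment N L :=
  𝓜 (m.transient 𝓜 t ω)

/-- The reward `X_t(a, a')`, with `X_t(a, ∅) = 0`. -/
def reward (m : Market N L P) (t : ℕ) (a : Agent N L) : Option (Partner a) → Ω → ℝ
  | none, _ => 0
  | some b, ω => m.X t a b ω

/-- The observed payoff `U_t(a, a'; ν_t) = X_t(a, a') - 𝒞(a, a'; ν_t) + 𝒯(a, a'; ν_t)`. -/
noncomputable def observed (m : Market N L P) (R : Rules N L) (𝓜 : Pref N L → Assignment N L)
    (t : ℕ) (a : Agent N L) (b : Option (Partner a)) (ω : Ω) : ℝ :=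
  m.reward t a b ω - R.cost (m.transient 𝓜 t ω) a b + R.transfer (m.transient 𝓜 t ω) a b

/-- At every time step `t ≥ 1`, the matching is one returned by the Gale-Shapley algorithm applied
over the payoffs `V(·, ·; ν_t)`. -/
def AppliesGS (m : Market N L P) (R : Rules N L) (𝓜 : Pref N L → Assignment N L) : Prop :=
  ∀ t, 1 ≤ t → ∀ ω, IsGSOutput (R.payoff (m.transient 𝓜 t ω)) (m.matchAt 𝓜 t ω)

/-- At every time step `t ≥ 1`, the matching is stable under the payoffs `V(·, ·; ν_t)`. -/
def IsIncentiveCompatible (m : Market N L P) (R : Rules N L) (𝓜 : Pref N L → Assignment N L) :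
    Prop :=
  ∀ t, 1 ≤ t → ∀ ω, m.matchAt 𝓜 t ω ∈ stableSet (R.payoff (m.transient 𝓜 t ω))

/-- The stable matchings under the true payoffs `V(·, ·; μ)`. -/
def trueStable (m : Market N L P) (R : Rules N L) : Set (Assignment N L) :=
  stableSet (R.payoff m.pref)

/-- The optimal matching for `a` at time `t`: a matching in `S(V(·, ·; μ))` that maximizes
`𝔼[U_t(a, M(a); ν_t)]`. -/
noncomputable def optimalMatching (m : Market N L P) (R : Rules N L)
    (𝓜 : Pref N L → Assignment N L) (a : Agent N L) (t : ℕ) : Assignment N L :=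
  Classical.epsilon fun M => M ∈ m.trueStable R ∧
    IsMaxOn (fun M' : Assignment N L => ∫ ω, m.observed R 𝓜 t a (M' a) ω ∂P) (m.trueStable R) M

/-- The pessimal matching for `a` at time `t`: a matching in `S(V(·, ·; μ))` that minimizes
`𝔼[U_t(a, M(a); ν_t)]`. -/
noncomputable def pessimalMatching (m : Market N L P) (R : Rules N L)
    (𝓜 : Pref N L → Assignment N L) (a : Agent N L) (t : ℕ) : Assignment N L :=
  Classical.epsilon fun M => M ∈ m.trueStable R ∧
    IsMinOn (fun M' : Assignment N L => ∫ ω, m.observed R 𝓜 t a (M' a) ω ∂P) (m.trueStable R) M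

/-- The loss of `a` at time `t` against the matching `M`:
`U_t(a, M(a); ν_t) - U_t(a, 𝓜(a; ν_t); ν_t)`. -/
noncomputable def loss (m : Market N L P) (R : Rules N L) (𝓜 : Pref N L → Assignment N L)
    (M : Assignment N L) (a : Agent N L) (t : ℕ) (ω : Ω) : ℝ :=
  m.observed R 𝓜 t a (M a) ω - m.observed R 𝓜 t a (m.matchAt 𝓜 t ω a) ω

/-- The optimal regret of `a` over the horizon `T`. -/
noncomputable def optimalRegret (m : Market N L P) (R : Rules N L)
    (𝓜 : Pref N L → Assignment N L) (a : Agent N L) (T : ℕ) : ℝ :=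
  ∫ ω, ∑ t ∈ Finset.Icc 1 T, m.loss R 𝓜 (m.optimalMatching R 𝓜 a t) a t ω ∂P

/-- The pessimal regret of `a` over the horizon `T`. -/
noncomputable def pessimalRegret (m : Market N L P) (R : Rules N L)
    (𝓜 : Pref N L → Assignment N L) (a : Agent N L) (T : ℕ) : ℝ :=
  ∫ ω, ∑ t ∈ Finset.Icc 1 T, m.loss R 𝓜 (m.pessimalMatching R 𝓜 a t) a t ω ∂P

end Market

/-- A regret that is `O(log T)`: bounded above by a multiple of `log T` for large `T`
(regrets may be negative). -/
def IsLogBounded (r : ℕ → ℝ) : Prop := ∃ C : ℝ, ∀ᶠ T : ℕ in atTop, r T ≤ C * Real.log T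

/-- A regret that is `ω(log T)`: eventually above every multiple of `log T`. -/
def IsSuperLog (r : ℕ → ℝ) : Prop := ∀ C : ℝ, ∀ᶠ T : ℕ in atTop, C * Real.log T ≤ r T

namespace Market

variable {N L : ℕ} {Ω : Type*} [MeasurableSpace Ω] {P : Measure Ω}

/-- Some agents have optimal regret `O(log T)` while others have optimal regret `ω(log T)`. -/
def IsUnfair (m : Market N L P) (R : Rules N L) (𝓜 : Pref N L → Assignment N L) : Prop :=
  ∃ A : Finset (Agent N L), 0 < A.card ∧ A.card < Fintype.card (Agent N L) ∧
    ∃ a ∈ A, ∃ a' ∉ A, IsLogBounded (m.optimalRegret R 𝓜 a) ∧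
      IsSuperLog (m.optimalRegret R 𝓜 a')

def IsFair (m : Market N L P) (R : Rules N L) (𝓜 : Pref N L → Assignment N L) : Prop :=
  ¬ m.IsUnfair R 𝓜

/-- `Δ_min`: the least gap `|μ(a₁, a₂) - μ(a₁, a₃)|`, where `a₂ ≠ a₃` range over the possible
partners of `a₁` and `∅`. -/
noncomputable def gapMin (m : Market N L P) : ℝ :=
  sInf {d | ∃ (a : Agent N L) (b c : Option (Partner a)), b ≠ c ∧ d = |m.pref a b - m.pref a c|}

/-- `2B(L - 1) 1(a ∈ 𝒰) + max_{a'} (μ(a, M(a)) - μ(a, a'))`, where `a'` ranges over the possible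
partners of `a` and `∅`. -/
noncomputable def gapMax (m : Market N L P) (B : ℝ) (M : Assignment N L) (a : Agent N L) : ℝ :=
  (if a.isLeft then 2 * B * ((L : ℝ) - 1) else 0)
    + ⨆ b : Option (Partner a), (m.pref a (M a) - m.pref a b)

end Market

end MatchingBandits

open MatchingBandits

/-!
Incentive compatibility is the classical fact that Gale-Shapley matchings are stable
(`IsGSOutput.isStable`).

For the regret bound, the prices drop by `2B` from one provider to the next while true preferences
of users lie in `[0, B]`, so that all users rank the providers in the same way and the true stable
matching is unique: the providers choose in turn (`exists_stableSet_eq_singleton`). Whenever the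
matching used differs from it, there is a pair that blocks under the true payoffs but not under the
upper confidence bounds, so an agent misjudges its match. By the usual argument for upper confidence
bounds (`Market.exists_deviation_or_count_lt`), an empirical mean then deviates by its confidence
radius, or the match has been sampled fewer than `8σ²α log T / Δ_min²` times. The second case
happens at most that often for each ordered pair of an agent and a partner. The first has probability
at most `t ^ (1 - α)` in each direction (`Market.measureReal_deviation_le`): since samples are
collected adaptively, this rests on the exponential supermartingale of the sampled rewards
(`Market.lintegral_chernoffWeight_le_one`) and a union bound over the number of samples.

Summing over the `2NL` ordered pairs bounds the expected number of mismatches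
(`Market.sum_measureReal_matchAt_ne_le`). As the matching at time `t` is independent of the rewards
at time `t`, each mismatch costs `a` at most `Δ*_max(a)` on average (`Market.integral_loss_le`).
Every regret is therefore `O(log T)`, none is `ω(log T)`, and the mechanism is fair.
-/

namespace MatchingBandits

/-! ### Stability of the Gale-Shapley matchings -/

/-- The invariant of the Gale-Shapley loop: the tentative matching is consistent, the queues stay
sorted, a matched provider likes nobody left in its queue better than its match (`held`), and a user
that has left the queue of `p` is matched at least as well as with `p` (`popped`). -/
structure GSInvariant {N L : ℕ} (V : Pref N L) (s : GSState N L) : Prop where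
  symm : ∀ (u : Fin N) (p : Fin L),
    s.matching (.inl u) = some p ↔ s.matching (.inr p) = some u
  sorted : ∀ p, (s.queue p).Pairwise
    fun u u' => V (.inr p) (some u') ≤ V (.inr p) (some u)
  held : ∀ (p : Fin L) (u : Fin N), s.matching (.inr p) = some u →
    ∀ u' ∈ s.queue p, V (.inr p) (some u') ≤ V (.inr p) (some u)
  popped : ∀ (p : Fin L) (u : Fin N), u ∉ s.queue p →
    ∃ p' : Fin L, s.matching (.inl u) = some p' ∧ V (.inl u) (some p) ≤ V (.inl u) (some p')

theorem GSInvariant.step {N L : ℕ} {V : Pref N L} {s s' : GSState N L}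
    (hs : GSInvariant V s) (h : GSStep V s s') : GSInvariant V s' := by
  obtain ⟨h1, h2, h3, h4⟩ := hs
  cases h with
  | accept p u q hp hq hu =>
    have hpw := h2 p
    rw [hq, List.pairwise_cons] at hpw
    refine ⟨fun v r => ?_, fun r => ?_, fun r v hv w hw => ?_, fun r v hv => ?_⟩
    · have := h1 v r
      have := h1 u r
      have := h1 v p
      rcases eq_or_ne v u with rfl | hv <;> rcases eq_or_ne r p with rfl | hr <;>
        simp_all [Ne.symm]
    · by_cases hr : r = p
      · subst hr; simpa using hpw.2
      · simpa [hr] using h2 r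
    · by_cases hr : r = p
      · subst hr
        simp at hv hw
        subst hv
        exact hpw.1 w hw
      · simp [hr] at hv hw
        exact h3 r v hv w hw
    · by_cases hvu : v = u
      · subst hvu
        refine ⟨p, by simp, ?_⟩
        by_cases hr : r = p
        · rw [hr]
        · simp [hr] at hv
          obtain ⟨p', hp', -⟩ := h4 r v hv
          simp_all
      · have : v ∉ s.queue r := by
          by_cases hr : r = p
          · subst hr; simp at hv; simp [hq, hvu, hv]
          · simpa [hr] using hv
        obtain ⟨p', hp', hle⟩ := h4 r v this
        exact ⟨p', by simp [hvu, hp'], hle⟩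
  | swap p p' u q hp hq hu hlt =>
    have hpw := h2 p
    rw [hq, List.pairwise_cons] at hpw
    have hne : p ≠ p' := by rintro rfl; exact lt_irrefl _ hlt
    have hup : s.matching (.inr p') = some u := (h1 u p').1 hu
    refine ⟨fun v r => ?_, fun r => ?_, fun r v hv w hw => ?_, fun r v hv => ?_⟩
    · have := h1 v r
      have := h1 u r
      have := h1 v p
      have := h1 v p'
      rcases eq_or_ne v u with rfl | hv <;> rcases eq_or_ne r p with rfl | hr <;>
        rcases eq_or_ne r p' with rfl | hr' <;> simp_all [Ne.symm]
    · by_cases hr : r = p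
      · subst hr; simpa using hpw.2
      · simpa [hr] using h2 r
    · by_cases hr : r = p
      · subst hr
        simp at hv hw
        subst hv
        exact hpw.1 w hw
      · by_cases hr' : r = p'
        · subst hr'
          simp [hr] at hv
        · simp [hr, hr'] at hv hw
          exact h3 r v hv w hw
    · by_cases hvu : v = u
      · subst hvu
        refine ⟨p, by simp, ?_⟩
        by_cases hr : r = p
        · rw [hr]
        · simp [hr] at hv
          obtain ⟨p'', hp'', hle⟩ := h4 r v hv
          obtain rfl : p' = p'' := by simpa [hu] using hp''
          exact hle.trans hlt.le
      · have : v ∉ s.queue r := by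
          by_cases hr : r = p
          · subst hr; simp at hv; simp [hq, hvu, hv]
          · simpa [hr] using hv
        obtain ⟨p'', hp'', hle⟩ := h4 r v this
        exact ⟨p'', by simp [hvu, hp''], hle⟩
  | reject p p' u q hp hq hu hle' =>
    have hpw := h2 p
    rw [hq, List.pairwise_cons] at hpw
    refine ⟨h1, fun r => ?_, fun r v hv w hw => ?_, fun r v hv => ?_⟩
    · by_cases hr : r = p
      · subst hr; simpa using hpw.2
      · simpa [hr] using h2 r
    · by_cases hr : r = p
      · subst hr; simp_all
      · simp [hr] at hw
        exact h3 r v hv w hw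
    · by_cases hr : r = p
      · subst hr
        by_cases hvu : v = u
        · subst hvu
          exact ⟨p', hu, hle'⟩
        · simp at hv
          exact h4 r v (by simp [hq, hvu, hv])
      · simp [hr] at hv
        exact h4 r v hv

/-- Every matching returned by the Gale-Shapley algorithm is stable, however ties are broken. -/
theorem IsGSOutput.isStable {N L : ℕ} {V : Pref N L} {M : Assignment N L}
    (h : IsGSOutput V M) : IsStable V M := by
  obtain ⟨Q₀, Q, hQ, hstep, hM⟩ := h
  have inv : GSInvariant V ⟨M, Q⟩ := by
    have h0 : GSInvariant V ⟨fun _ => none, Q₀⟩ :=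
      ⟨fun _ _ => by simp, fun p => (hQ p).2.2, fun p u hu => by simp at hu,
        fun p u hu => absurd ((hQ p).2.1 u) hu⟩
    generalize (⟨M, Q⟩ : GSState N L) = s at hstep
    induction hstep with
    | refl => exact h0
    | tail _ hs ih => exact ih.step hs
  refine ⟨⟨inv.symm, hM⟩, ?_⟩
  rintro ⟨u, p, hu, hp⟩
  obtain ⟨v, hv⟩ := Option.ne_none_iff_exists'.1 (hM p)
  rw [hv] at hp
  have hnot : u ∉ Q p := fun hmem => not_le_of_gt hp (inv.held p v hv u hmem)
  obtain ⟨p', hp', hle⟩ := inv.popped p u hnot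
  simp only at hp'
  rw [hp'] at hu
  exact not_le_of_gt hu hle

/-! ### Uniqueness of the stable matching when users agree on the ranking -/

/-- If all users strictly prefer providers with larger `k`, and being matched to being unmatched,
and no provider is indifferent between users, there is exactly one stable matching: the one in
which the providers choose their users in turn, in decreasing order of `k`. -/
theorem exists_stableSet_eq_singleton {N L : ℕ} (hLN : L ≤ N) {V : Pref N L} (k : Fin L ≃ Fin L)
    (hnone : ∀ u p, V (.inl u) none < V (.inl u) (some p))
    (hrank : ∀ u p q, k q < k p → V (.inl u) (some q) < V (.inl u) (some p))
    (hinj : ∀ p, Function.Injective fun u : Fin N => V (.inr p) (some u)) :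
    ∃ M, stableSet V = {M} := by
  classical
  -- The injection with lexicographically largest payoffs, in decreasing order of `k`, is stable:
  -- exchanging `u` and the match of `p` for a blocking pair `(u, p)` would enlarge it.
  have hex : ∃ M, IsStable V M := by
    let score : (Fin L ↪ Fin N) → Lex (Fin L → ℝ) :=
      fun f => toLex fun i => V (.inr (k.symm i.rev)) (some (f (k.symm i.rev)))
    have : Nonempty (Fin L ↪ Fin N) := ⟨Fin.castLEEmb hLN⟩
    obtain ⟨f, hf⟩ := Finite.exists_max score
    let M : Assignment N L := fun a => match a with
      | .inl u => if h : ∃ p, f p = u then some h.choose else none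
      | .inr p => some (f p)
    have hMl : ∀ u p, M (.inl u) = some p ↔ f p = u := by
      intro u p
      by_cases h : ∃ p, f p = u
      · have h' : M (.inl u) = some h.choose := dif_pos h
        rw [h', Option.some_inj]
        constructor
        · rintro rfl; exact h.choose_spec
        · intro hp; exact f.injective (h.choose_spec.trans hp.symm)
      · have h' : M (.inl u) = none := dif_neg h
        rw [h']
        simp only [reduceCtorEq, false_iff]
        exact fun hp => h ⟨p, hp⟩
    have hMr : ∀ p, M (.inr p) = some (f p) := fun p => rfl
    refine ⟨M, ⟨fun u p => ?_, fun p => by simp [hMr]⟩, ?_⟩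
    · rw [hMl, hMr, Option.some_inj]
    rintro ⟨u, p, hu, hp⟩
    rw [hMr] at hp
    let f' : Fin L ↪ Fin N := f.trans (Equiv.swap u (f p)).toEmbedding
    refine not_lt_of_ge (hf f') ⟨(k p).rev, fun j hj => ?_, ?_⟩
    · have hj' : k p < j.rev := Fin.lt_rev_iff.2 (by simpa using hj)
      set q := k.symm j.rev with hq
      have hkq : k q = j.rev := by simp [hq]
      have h1 : f q ≠ f p := fun h => by
        rw [f.injective h] at hkq; rw [hkq] at hj'; exact lt_irrefl _ hj'
      have h2 : f q ≠ u := fun h => by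
        rw [(hMl u q).2 h] at hu
        exact lt_asymm hu (hrank u q p (hkq ▸ hj'))
      show V (.inr q) (some (f q)) = V (.inr q) (some (Equiv.swap u (f p) (f q)))
      rw [Equiv.swap_apply_of_ne_of_ne h2 h1]
    · show V (.inr (k.symm (k p).rev.rev)) (some (f (k.symm (k p).rev.rev))) <
        V (.inr (k.symm (k p).rev.rev)) (some (Equiv.swap u (f p) (f (k.symm (k p).rev.rev))))
      rw [Fin.rev_rev, k.symm_apply_apply, Equiv.swap_apply_right]
      exact hp
  -- In decreasing order of `k`: if `M` and `M'` agree on all providers above `p` and `p` is better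
  -- off in `M'`, then `p` blocks `M` with its match in `M'`, who has nobody above `p` in `M`.
  have key : ∀ M M' : Assignment N L, IsStable V M → IsStable V M' → ∀ p u u',
      (∀ q, k p < k q → M (.inr q) = M' (.inr q)) → M (.inr p) = some u →
      M' (.inr p) = some u' → ¬ V (.inr p) (some u) < V (.inr p) (some u') := by
    intro M M' hM hM' p u u' hq hu hu' hlt
    refine hM.2 ⟨u', p, ?_, by rwa [hu]⟩
    cases hMu : M (.inl u') with
    | none => exact hnone u' p
    | some q =>
      have hMq := (hM.1.1 u' q).1 hMu
      refine hrank u' p q (lt_of_le_of_ne (le_of_not_gt fun hpq => ?_) fun h => ?_)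
      · rw [hq q hpq] at hMq
        have h1 := (hM'.1.1 u' q).2 hMq
        rw [(hM'.1.1 u' p).2 hu'] at h1
        rw [Option.some_inj.1 h1] at hpq
        exact lt_irrefl _ hpq
      · rw [k.injective h, hu] at hMq
        rw [Option.some_inj.1 hMq] at hlt
        exact lt_irrefl _ hlt
  obtain ⟨M, hM⟩ := hex
  refine ⟨M, Set.eq_singleton_iff_unique_mem.2 ⟨hM, fun M' hM' => ?_⟩⟩
  have hr : ∀ p, M (.inr p) = M' (.inr p) := by
    suffices h : ∀ i : Fin L, M (.inr (k.symm i)) = M' (.inr (k.symm i)) by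
      intro p
      have := h (k p)
      rwa [k.symm_apply_apply] at this
    intro i
    induction i using WellFoundedGT.induction with
    | ind i ih =>
      set p := k.symm i with hp
      have hq : ∀ q, k p < k q → M (.inr q) = M' (.inr q) := fun q hpq => by
        have := ih (k q) (by simpa [hp] using hpq)
        rwa [k.symm_apply_apply] at this
      obtain ⟨u, hu⟩ := Option.ne_none_iff_exists'.1 (hM.1.2 p)
      obtain ⟨u', hu'⟩ := Option.ne_none_iff_exists'.1 (hM'.1.2 p)
      have h1 := key M M' hM hM' p u u' hq hu hu'
      have h2 := key M' M hM' hM p u' u (fun q h => (hq q h).symm) hu' hu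
      rw [hu, hu', hinj p (le_antisymm (not_lt.1 h2) (not_lt.1 h1))]
  funext a
  rcases a with u | p
  · refine Option.ext fun p => ?_
    rw [hM.1.1, hM'.1.1, hr]
  · exact (hr p).symm

/-! ### Independence of past and future samples -/

theorem lintegral_exp_sub_le_one {Ω : Type*} [MeasurableSpace Ω] {P : Measure Ω} {Y : Ω → ℝ}
    {c : NNReal} (h : HasSubgaussianMGF Y c P) (s : ℝ) :
    ∫⁻ ω, ENNReal.ofReal (Real.exp (s * Y ω - c * s ^ 2 / 2)) ∂P ≤ 1 := by
  have hint : Integrable (fun ω => Real.exp (s * Y ω - c * s ^ 2 / 2)) P := by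
    simp_rw [Real.exp_sub]
    exact (h.integrable_exp_mul s).div_const _
  rw [← ofReal_integral_eq_lintegral_ofReal hint (ae_of_all _ fun _ => (Real.exp_pos _).le),
    ENNReal.ofReal_le_one]
  simp_rw [Real.exp_sub]
  rw [integral_div, div_le_one (Real.exp_pos _)]
  exact h.mgf_le s

namespace Market

variable {N L : ℕ} {Ω : Type*} [mΩ : MeasurableSpace Ω] {P : Measure Ω}

/-- The joint family of all noisy samples of the market. -/
def sample (m : Market N L P) (i : SampleIndex m.T₀) : Ω → ℝ :=
  Sum.elim (fun x : ℕ × Σ a : Agent N L, Partner a => m.X x.1 x.2.1 x.2.2)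
    (fun y : Σ x : Σ a : Agent N L, Partner a, Fin (m.T₀ x.1 x.2) => m.X₀ y.1.1 y.1.2 y.2) i

theorem measurable_sample (m : Market N L P) (i : SampleIndex m.T₀) : Measurable (m.sample i) := by
  rcases i with x | y
  · exact m.X_measurable _ _ _
  · exact m.X₀_measurable _ _ _

/-- Indices of the samples available after time `n`: the initial ones and those up to time `n`. -/
def pastIndex (m : Market N L P) (n : ℕ) : Set (SampleIndex m.T₀) :=
  {i | ∀ x, i = .inl x → x.1 ≤ n}

/-- The σ-algebra generated by the initial samples and the rewards at the times `1, …, n`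
(and `0`), including those that are not observed. -/
@[reducible] def past (m : Market N L P) (n : ℕ) : MeasurableSpace Ω :=
  ⨆ i ∈ m.pastIndex n, MeasurableSpace.comap (m.sample i) inferInstance

theorem past_le (m : Market N L P) (n : ℕ) : m.past n ≤ mΩ :=
  iSup₂_le fun i _ => (m.measurable_sample i).comap_le

theorem past_mono (m : Market N L P) {n n' : ℕ} (h : n ≤ n') : m.past n ≤ m.past n' :=
  biSup_mono fun _ hi x hx => (hi x hx).trans h

theorem measurable_past_X (m : Market N L P) {n t : ℕ} (h : t ≤ n) (a : Agent N L)
    (b : Partner a) : Measurable[m.past n] (m.X t a b) := by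
  refine Measurable.of_comap_le (le_iSup₂_of_le (.inl (t, ⟨a, b⟩)) ?_ le_rfl)
  rintro x hx
  obtain rfl := Sum.inl.inj hx
  exact h

theorem measurable_past_X₀ (m : Market N L P) (n : ℕ) (a : Agent N L)
    (b : Partner a) (i : Fin (m.T₀ a b)) : Measurable[m.past n] (m.X₀ a b i) := by
  refine Measurable.of_comap_le (le_iSup₂_of_le (.inr ⟨⟨a, b⟩, i⟩) ?_ le_rfl)
  rintro x hx
  cases hx

/-- The rewards at time `n + 1` are independent of everything up to time `n`. -/
theorem indep_past (m : Market N L P) (n : ℕ) (a : Agent N L) (b : Partner a) :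
    Indep (m.past n) (MeasurableSpace.comap (m.X (n + 1) a b) inferInstance) P := by
  have h := indep_iSup_of_disjoint (m := fun i => MeasurableSpace.comap (m.sample i) inferInstance)
    (fun i => (m.measurable_sample i).comap_le) m.indep
    (S := m.pastIndex n) (T := {.inl (n + 1, ⟨a, b⟩)}) (by
      rw [Set.disjoint_singleton_right]
      intro h
      have := h _ rfl
      simp at this)
  rw [iSup_singleton] at h
  exact h

theorem measurable_ucb {Ω' : Type*} {mΩ' : MeasurableSpace Ω'} (m : Market N L P) (t : ℕ)
    {s : Ω' → Samples N L} (hc : ∀ a b, Measurable fun ω => (s ω).count a b)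
    (ht : ∀ a b, Measurable fun ω => (s ω).total a b) : Measurable fun ω => m.ucb t (s ω) := by
  refine measurable_pi_iff.2 fun a => measurable_pi_iff.2 fun b => ?_
  cases b with
  | none => exact measurable_const
  | some b =>
    have hc' : Measurable fun ω => ((s ω).count a b : ℝ) :=
      (measurable_from_nat (f := fun n : ℕ => (n : ℝ))).comp (hc a b)
    have := ht a b
    simp only [ucb]
    fun_prop

theorem measurableSet_preimage_matching {Ω' : Type*} {mΩ' : MeasurableSpace Ω'}
    {𝓜 : Pref N L → Assignment N L} (h𝓜 : ∀ M', MeasurableSet (𝓜 ⁻¹' {M'}))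
    {f : Ω' → Pref N L} (hf : Measurable f) (S : Set (Assignment N L)) :
    MeasurableSet {ω | 𝓜 (f ω) ∈ S} := by
  have : {ω | 𝓜 (f ω) ∈ S} = f ⁻¹' ⋃ M' ∈ S, 𝓜 ⁻¹' {M'} := by
    ext ω; simp
  rw [this]
  exact hf (MeasurableSet.biUnion S.to_countable fun M' _ => h𝓜 M')

variable {𝓜 : Pref N L → Assignment N L}

theorem measurable_add_ite {Ω' : Type*} {mΩ' : MeasurableSpace Ω'} {c : Ω' → ℕ} {T X : Ω' → ℝ}
    {p : Ω' → Prop} [DecidablePred p] (hp : MeasurableSet {ω | p ω}) (hc : Measurable c)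
    (hT : Measurable T) (hX : Measurable X) :
    (Measurable fun ω => c ω + if p ω then 1 else 0) ∧
      Measurable fun ω => T ω + if p ω then X ω else 0 :=
  ⟨hc.add (Measurable.ite hp measurable_const measurable_const),
    hT.add (Measurable.ite hp hX measurable_const)⟩

/-- What has been learned by time `n` depends on the samples up to time `n` only. -/
theorem measurable_past_samples (m : Market N L P) (h𝓜 : ∀ M', MeasurableSet (𝓜 ⁻¹' {M'}))
    (n : ℕ) (a : Agent N L) (b : Partner a) :
    Measurable[m.past n] (fun ω => (m.samples 𝓜 ω n).count a b) ∧
      Measurable[m.past n] (fun ω => (m.samples 𝓜 ω n).total a b) := by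
  induction n generalizing a b with
  | zero =>
    exact ⟨@measurable_const _ _ _ (m.past 0) _,
      Finset.measurable_fun_sum (m := m.past 0) Finset.univ
        fun i _ => m.measurable_past_X₀ 0 a b i⟩
  | succ n ih =>
    have hle := m.past_mono n.le_succ
    have h1 : ∀ a b, Measurable[m.past (n + 1)] (fun ω => (m.samples 𝓜 ω n).count a b) :=
      fun a b => (ih a b).1.mono hle le_rfl
    have h2 : ∀ a b, Measurable[m.past (n + 1)] (fun ω => (m.samples 𝓜 ω n).total a b) :=
      fun a b => (ih a b).2.mono hle le_rfl
    exact measurable_add_ite (mΩ' := m.past (n + 1))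
      (measurableSet_preimage_matching h𝓜 (m.measurable_ucb (n + 1) h1 h2) {M | M a = some b})
      (h1 a b) (h2 a b) (m.measurable_past_X le_rfl a b)

theorem measurable_past_transient (m : Market N L P) (h𝓜 : ∀ M', MeasurableSet (𝓜 ⁻¹' {M'}))
    (n : ℕ) : Measurable[m.past n] (m.transient 𝓜 (n + 1)) :=
  m.measurable_ucb (n + 1) (fun a b => (m.measurable_past_samples h𝓜 n a b).1)
    (fun a b => (m.measurable_past_samples h𝓜 n a b).2)

/-- The matching at time `n + 1` is decided by the samples up to time `n`. -/
theorem measurableSet_past_matchAt (m : Market N L P) (h𝓜 : ∀ M', MeasurableSet (𝓜 ⁻¹' {M'}))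
    (n : ℕ) (S : Set (Assignment N L)) :
    MeasurableSet[m.past n] {ω | m.matchAt 𝓜 (n + 1) ω ∈ S} :=
  measurableSet_preimage_matching h𝓜 (m.measurable_past_transient h𝓜 n) S

/-! ### Concentration of the adaptively sampled means -/

theorem hasSubgaussianMGF_X (m : Market N L P) (t : ℕ) (a : Agent N L) (b : Partner a) :
    HasSubgaussianMGF (fun ω => m.X t a b ω - m.pref a (some b)) (Real.toNNReal (m.σ ^ 2)) P := by
  have h := m.D_subgaussian a b
  rw [← m.X_law t a b] at h
  exact HasSubgaussianMGF.of_map (m.X_measurable t a b).aemeasurable h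

theorem hasSubgaussianMGF_X₀ (m : Market N L P) (a : Agent N L) (b : Partner a)
    (i : Fin (m.T₀ a b)) :
    HasSubgaussianMGF (fun ω => m.X₀ a b i ω - m.pref a (some b)) (Real.toNNReal (m.σ ^ 2)) P := by
  have h := m.D_subgaussian a b
  rw [← m.X₀_law a b i] at h
  exact HasSubgaussianMGF.of_map (m.X₀_measurable a b i).aemeasurable h

theorem integrable_X (m : Market N L P) [IsProbabilityMeasure P] (t : ℕ) (a : Agent N L)
    (b : Partner a) : Integrable (m.X t a b) P := by
  have h := (m.hasSubgaussianMGF_X t a b).integrable.add (integrable_const (m.pref a (some b)))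
  refine h.congr (ae_of_all _ fun ω => ?_)
  simp

theorem integral_X (m : Market N L P) (t : ℕ) (a : Agent N L) (b : Partner a) :
    ∫ ω, m.X t a b ω ∂P = m.pref a (some b) := by
  rw [← m.D_mean a b, ← m.X_law t a b]
  exact (integral_map (f := id) (m.X_measurable t a b).aemeasurable aestronglyMeasurable_id).symm

/-- The exponential process `exp(s · (centered sum) - count · σ² s² / 2)` of the samples that `a`
has of `b` after time `n`, with parameter `s`. -/
noncomputable def chernoffWeight (m : Market N L P) (𝓜 : Pref N L → Assignment N L) (a : Agent N L)
    (b : Partner a) (s : ℝ) (n : ℕ) (ω : Ω) : ENNReal :=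
  ENNReal.ofReal (Real.exp (s * ((m.samples 𝓜 ω n).total a b
    - (m.samples 𝓜 ω n).count a b * m.pref a (some b))
    - (m.samples 𝓜 ω n).count a b * (m.σ ^ 2 * s ^ 2 / 2)))

theorem measurable_past_chernoffWeight (m : Market N L P) (h𝓜 : ∀ M', MeasurableSet (𝓜 ⁻¹' {M'}))
    (a : Agent N L) (b : Partner a) (s : ℝ) (n : ℕ) :
    Measurable[m.past n] (m.chernoffWeight 𝓜 a b s n) := by
  have h : ∀ {Ω' : Type _} {mΩ' : MeasurableSpace Ω'} {c : Ω' → ℕ} {T : Ω' → ℝ},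
      Measurable c → Measurable T → Measurable fun ω => ENNReal.ofReal (Real.exp
        (s * (T ω - c ω * m.pref a (some b)) - c ω * (m.σ ^ 2 * s ^ 2 / 2))) := by
    intro Ω' mΩ' c T hc hT
    have hc' : Measurable fun ω => (c ω : ℝ) :=
      (measurable_from_nat (f := fun n : ℕ => (n : ℝ))).comp hc
    fun_prop
  exact h (m.measurable_past_samples h𝓜 n a b).1 (m.measurable_past_samples h𝓜 n a b).2

/-- The exponential process has mean at most `1` initially and is a supermartingale: whether `b` is
sampled at time `n + 1` is decided by the past, and the sample itself is independent of the past. -/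
theorem lintegral_chernoffWeight_le_one (m : Market N L P)
    (h𝓜 : ∀ M', MeasurableSet (𝓜 ⁻¹' {M'})) (a : Agent N L) (b : Partner a) (s : ℝ) (n : ℕ) :
    ∫⁻ ω, m.chernoffWeight 𝓜 a b s n ω ∂P ≤ 1 := by
  have hσ : ((Real.toNNReal (m.σ ^ 2) : NNReal) : ℝ) = m.σ ^ 2 := Real.coe_toNNReal _ (sq_nonneg _)
  induction n with
  | zero =>
    have hind : iIndepFun (fun (i : Fin (m.T₀ a b)) ω => m.X₀ a b i ω - m.pref a (some b)) P := by
      have h := m.indep.precomp (g := fun i : Fin (m.T₀ a b) => Sum.inr ⟨⟨a, b⟩, i⟩)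
        (fun i j hij => by simpa using hij)
      exact h.comp (fun _ x => x - m.pref a (some b)) fun _ => by fun_prop
    have h := lintegral_exp_sub_le_one (HasSubgaussianMGF.sum_of_iIndepFun hind
      (s := Finset.univ) fun i _ => m.hasSubgaussianMGF_X₀ a b i) s
    refine le_of_eq_of_le (lintegral_congr fun ω => ?_) h
    simp only [chernoffWeight, samples, Finset.sum_sub_distrib, Finset.sum_const, Finset.card_univ,
      Fintype.card_fin, nsmul_eq_mul, NNReal.coe_mul, NNReal.coe_natCast, hσ]
    ring_nf
  | succ n ih =>
    classical
    set A : Set Ω := {ω | m.matchAt 𝓜 (n + 1) ω a = some b} with hA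
    have hAm : MeasurableSet[m.past n] A := m.measurableSet_past_matchAt h𝓜 n {M | M a = some b}
    set Y : Ω → ENNReal := fun ω => ENNReal.ofReal
      (Real.exp (s * (m.X (n + 1) a b ω - m.pref a (some b)) - m.σ ^ 2 * s ^ 2 / 2)) with hY
    set Z := m.chernoffWeight 𝓜 a b s n with hZ
    have hZm : Measurable[m.past n] Z := m.measurable_past_chernoffWeight h𝓜 a b s n
    have hY1 : ∫⁻ ω, Y ω ∂P ≤ 1 := by
      have h := lintegral_exp_sub_le_one (m.hasSubgaussianMGF_X (n + 1) a b) s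
      rwa [hσ] at h
    have hYm : Measurable[MeasurableSpace.comap (m.X (n + 1) a b) inferInstance] Y :=
      (show Measurable fun x : ℝ => ENNReal.ofReal
        (Real.exp (s * (x - m.pref a (some b)) - m.σ ^ 2 * s ^ 2 / 2)) by fun_prop).comp
        (comap_measurable _)
    have hsplit : ∀ ω, m.chernoffWeight 𝓜 a b s (n + 1) ω
        = A.indicator Z ω * Y ω + Aᶜ.indicator Z ω := by
      intro ω
      by_cases hω : ω ∈ A
      · have hω' : 𝓜 (m.ucb (n + 1) (m.samples 𝓜 ω n)) a = some b := hω
        simp only [hω, Set.indicator_of_mem, Set.mem_compl_iff, not_true_eq_false,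
          not_false_eq_true, Set.indicator_of_notMem, add_zero, hZ, hY, chernoffWeight, samples,
          hω', if_true]
        rw [← ENNReal.ofReal_mul (Real.exp_pos _).le, ← Real.exp_add]
        push_cast
        ring_nf
      · have hω' : ¬ 𝓜 (m.ucb (n + 1) (m.samples 𝓜 ω n)) a = some b := hω
        simp [hω, hZ, chernoffWeight, samples, hω']
    have hle := m.past_le n
    calc ∫⁻ ω, m.chernoffWeight 𝓜 a b s (n + 1) ω ∂P
        = ∫⁻ ω, A.indicator Z ω * Y ω ∂P + ∫⁻ ω, Aᶜ.indicator Z ω ∂P := by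
          simp_rw [hsplit]
          exact lintegral_add_right _ ((hZm.mono hle le_rfl).indicator (hle _ hAm).compl)
      _ = (∫⁻ ω, A.indicator Z ω ∂P) * ∫⁻ ω, Y ω ∂P + ∫⁻ ω, Aᶜ.indicator Z ω ∂P := by
          rw [lintegral_mul_eq_lintegral_mul_lintegral_of_independent_measurableSpace hle
            (m.X_measurable _ _ _).comap_le (m.indep_past n a b)
            (Measurable.indicator (m := m.past n) hZm hAm) hYm]
      _ ≤ ∫⁻ ω, A.indicator Z ω ∂P + ∫⁻ ω, Aᶜ.indicator Z ω ∂P := by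
          gcongr
          exact mul_le_of_le_one_right' hY1
      _ = ∫⁻ ω, Z ω ∂P := by
          rw [← lintegral_add_right _ ((hZm.mono hle le_rfl).indicator (hle _ hAm).compl)]
          simp_rw [Set.indicator_self_add_compl_apply]
      _ ≤ 1 := ih

theorem count_mem_Icc (m : Market N L P) (ω : Ω) (n : ℕ) (a : Agent N L) (b : Partner a) :
    (m.samples 𝓜 ω n).count a b ∈ Finset.Icc (m.T₀ a b) (m.T₀ a b + n) := by
  rw [Finset.mem_Icc]
  induction n with
  | zero => simp [samples]
  | succ n ih =>
    simp only [samples]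
    split_ifs <;> omega

/-- The confidence radius at time `t` for `c` samples. -/
noncomputable def radius (m : Market N L P) (t c : ℕ) : ℝ :=
  Real.sqrt (2 * m.σ ^ 2 * m.α * Real.log t / c)

/-- The event that the empirical mean that enters `ν_t(a, b)` misses `μ(a, b)` by at least the
confidence radius: from above for `ε = 1`, from below for `ε = -1`. -/
def deviation (m : Market N L P) (𝓜 : Pref N L → Assignment N L) (ε : ℝ) (a : Agent N L)
    (b : Partner a) (t : ℕ) : Set Ω :=
  {ω | m.radius t ((m.samples 𝓜 ω (t - 1)).count a b) ≤
    ε * ((m.samples 𝓜 ω (t - 1)).total a b / (m.samples 𝓜 ω (t - 1)).count a b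
      - m.pref a (some b))}

/-- The number of samples is random and correlated with their values, so the Chernoff bound is
applied to the exponential process, with the optimal parameter for each of the `t` possible values
of this number; each contributes at most `t ^ (-α)`. -/
theorem measureReal_deviation_le (m : Market N L P) [IsProbabilityMeasure P]
    (h𝓜 : ∀ M', MeasurableSet (𝓜 ⁻¹' {M'}))
    {ε : ℝ} (hε : ε ^ 2 = 1) (a : Agent N L) (b : Partner a) {t : ℕ} (ht : 1 ≤ t) :
    P.real (m.deviation 𝓜 ε a b t) ≤ (t : ℝ) ^ (1 - m.α) := by
  have ht0 : (0 : ℝ) < t := by exact_mod_cast ht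
  have hσ := m.σ_pos
  have hα := m.two_lt_α
  have hc : ∀ c ∈ Finset.Icc (m.T₀ a b) (m.T₀ a b + (t - 1)),
      P.real (m.deviation 𝓜 ε a b t ∩ {ω | (m.samples 𝓜 ω (t - 1)).count a b = c})
        ≤ (t : ℝ) ^ (- m.α) := by
    intro c hc
    have hc0 : (0 : ℝ) < c := by
      exact_mod_cast (m.T₀_pos a b).trans_le (Finset.mem_Icc.1 hc).1
    set r := m.radius t c with hr
    have hr2 : r ^ 2 * c = 2 * m.σ ^ 2 * (m.α * Real.log t) := by
      rw [hr, radius, Real.sq_sqrt]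
      · field_simp
      · have := Real.log_nonneg (show (1 : ℝ) ≤ t by exact_mod_cast ht)
        positivity
    have hr0 : 0 ≤ r := Real.sqrt_nonneg _
    have hsub : m.deviation 𝓜 ε a b t ∩ {ω | (m.samples 𝓜 ω (t - 1)).count a b = c} ⊆
        {ω | ENNReal.ofReal ((t : ℝ) ^ m.α) ≤
          m.chernoffWeight 𝓜 a b (ε * r / m.σ ^ 2) (t - 1) ω} := by
      rintro ω ⟨h1, h2⟩
      simp only [deviation, Set.mem_ofPred_eq] at h1 h2 ⊢
      rw [h2, ← hr] at h1
      refine ENNReal.ofReal_le_ofReal ?_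
      rw [Real.rpow_def_of_pos ht0, h2]
      refine Real.exp_le_exp.2 ?_
      set T := (m.samples 𝓜 ω (t - 1)).total a b
      set μ := m.pref a (some b)
      have h3 : r * c ≤ ε * (T - c * μ) := by
        calc r * c ≤ ε * (T / c - μ) * c := by gcongr
          _ = ε * (T - c * μ) := by field_simp
      have h4 : ε * r / m.σ ^ 2 * (T - c * μ) - c * (m.σ ^ 2 * (ε * r / m.σ ^ 2) ^ 2 / 2)
          = (r * (ε * (T - c * μ)) - ε ^ 2 * (r ^ 2 * c) / 2) / m.σ ^ 2 := by
        field_simp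
      rw [h4, hε, hr2, le_div_iff₀ (by positivity)]
      nlinarith [mul_le_mul_of_nonneg_left h3 hr0]
    have hmarkov := mul_meas_ge_le_lintegral₀ (μ := P)
      ((m.measurable_past_chernoffWeight h𝓜 a b (ε * r / m.σ ^ 2) (t - 1)).mono
        (m.past_le _) le_rfl).aemeasurable (ENNReal.ofReal ((t : ℝ) ^ m.α))
    have hP := hmarkov.trans (m.lintegral_chernoffWeight_le_one h𝓜 a b _ _)
    have hP' : ENNReal.ofReal ((t : ℝ) ^ m.α) * P (m.deviation 𝓜 ε a b t ∩
        {ω | (m.samples 𝓜 ω (t - 1)).count a b = c}) ≤ 1 :=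
      le_trans (by gcongr) hP
    have hpos : 0 < (t : ℝ) ^ m.α := Real.rpow_pos_of_pos ht0 _
    have hreal := ENNReal.toReal_mono ENNReal.one_ne_top hP'
    rw [ENNReal.toReal_mul, ENNReal.toReal_ofReal hpos.le, ENNReal.toReal_one] at hreal
    rw [Real.rpow_neg ht0.le, ← one_div, le_div_iff₀ hpos, mul_comm]
    exact hreal
  have hcover : m.deviation 𝓜 ε a b t ⊆ ⋃ c ∈ Finset.Icc (m.T₀ a b) (m.T₀ a b + (t - 1)),
      (m.deviation 𝓜 ε a b t ∩ {ω | (m.samples 𝓜 ω (t - 1)).count a b = c}) := fun ω hω =>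
    Set.mem_biUnion (m.count_mem_Icc ω (t - 1) a b) ⟨hω, rfl⟩
  calc P.real (m.deviation 𝓜 ε a b t) ≤ _ := measureReal_mono hcover (measure_ne_top P _)
    _ ≤ _ := measureReal_biUnion_finset_le _ _
    _ ≤ ∑ c ∈ Finset.Icc (m.T₀ a b) (m.T₀ a b + (t - 1)), (t : ℝ) ^ (- m.α) :=
        Finset.sum_le_sum hc
    _ = t * (t : ℝ) ^ (- m.α) := by
        rw [Finset.sum_const, Nat.card_Icc, nsmul_eq_mul]
        congr 2
        omega
    _ = (t : ℝ) ^ (1 - m.α) := by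
        rw [sub_eq_add_neg, Real.rpow_add ht0, Real.rpow_one]

end Market

theorem sum_Icc_two_rpow_le {α : ℝ} (hα : 2 < α) (T : ℕ) (hT : 1 ≤ T) :
    ∑ t ∈ Finset.Icc 2 T, (t : ℝ) ^ (1 - α) ≤ 1 / (α - 2) := by
  set β := α - 2 with hβ
  have hβ0 : 0 < β := by linarith
  suffices h : ∑ t ∈ Finset.Icc 2 T, (t : ℝ) ^ (1 - α) ≤ (1 / β) * (1 - (T : ℝ) ^ (-β)) by
    refine h.trans (mul_le_of_le_one_right (by positivity) ?_)
    linarith [Real.rpow_nonneg (Nat.cast_nonneg T : (0 : ℝ) ≤ T) (-β)]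
  induction T, hT using Nat.le_induction with
  | base => simp
  | succ n hn ih =>
    rw [Finset.sum_Icc_succ_top (by omega)]
    have hn0 : (0 : ℝ) < n := by exact_mod_cast hn
    have hn1 : (0 : ℝ) < n + 1 := by positivity
    -- Bernoulli's inequality in the form `1 + β / (n + 1) ≤ ((n + 1) / n) ^ β`
    have hlog : 1 / ((n : ℝ) + 1) ≤ Real.log ((n + 1) / n) := by
      have h := Real.one_sub_inv_le_log_of_pos (x := ((n : ℝ) + 1) / n) (by positivity)
      refine le_trans (le_of_eq ?_) h
      field_simp
      ring
    have hexp : 1 + β / ((n : ℝ) + 1) ≤ (((n : ℝ) + 1) / n) ^ β := by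
      rw [Real.rpow_def_of_pos (by positivity)]
      refine le_trans ?_ (Real.add_one_le_exp _)
      have := mul_le_mul_of_nonneg_right hlog hβ0.le
      rw [div_mul_eq_mul_div, one_mul] at this
      linarith
    have hmul : (((n : ℝ) + 1) / n) ^ β * ((n : ℝ) + 1) ^ (-β) = (n : ℝ) ^ (-β) := by
      rw [Real.div_rpow hn1.le hn0.le, Real.rpow_neg hn1.le, Real.rpow_neg hn0.le]
      have := (Real.rpow_pos_of_pos hn1 β).ne'
      field_simp
    have hpow : ((n : ℝ) + 1) ^ (1 - α) = ((n : ℝ) + 1) ^ (-β) / (n + 1) := by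
      rw [← Real.rpow_sub_one hn1.ne', hβ]
      congr 1
      ring
    have hq := Real.rpow_pos_of_pos hn1 (-β)
    have hstep := mul_le_mul_of_nonneg_right hexp hq.le
    rw [hmul] at hstep
    push_cast
    rw [hpow]
    have hid : ((n : ℝ) + 1) ^ (-β) / (n + 1)
        = (1 / β) * ((1 + β / ((n : ℝ) + 1)) * (n + 1) ^ (-β) - (n + 1) ^ (-β)) := by
      field_simp
      ring
    have hle := mul_le_mul_of_nonneg_left
      (sub_le_sub_right hstep (((n : ℝ) + 1) ^ (-β))) (by positivity : 0 ≤ 1 / β)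
    rw [← hid] at hle
    linarith

/-! ### The expected loss in terms of mismatches -/

/-- The cost and transfer rules add the constant offsets `h a b` to the preferences, whatever the
preferences are. -/
def Rules.HasOffset {N L : ℕ} (R : Rules N L) (h : Pref N L) : Prop :=
  ∀ ψ a b, - R.cost ψ a b + R.transfer ψ a b = h a b

theorem Rules.HasOffset.payoff_eq {N L : ℕ} {R : Rules N L} {h : Pref N L} (hR : R.HasOffset h)
    (ψ : Pref N L) (a : Agent N L) (b : Option (Partner a)) : R.payoff ψ a b = ψ a b + h a b := by
  rw [← hR ψ, Rules.payoff]; ring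

namespace Market

variable {N L : ℕ} {Ω : Type*} [mΩ : MeasurableSpace Ω] {P : Measure Ω}
  {𝓜 : Pref N L → Assignment N L} {R : Rules N L} {h : Pref N L}

theorem observed_eq (m : Market N L P) (hR : R.HasOffset h) (t : ℕ) (a : Agent N L)
    (b : Option (Partner a)) (ω : Ω) :
    m.observed R 𝓜 t a b ω = m.reward t a b ω + h a b := by
  rw [← hR (m.transient 𝓜 t ω), observed]; ring

theorem integrable_reward (m : Market N L P) [IsProbabilityMeasure P] (t : ℕ) (a : Agent N L)
    (b : Option (Partner a)) : Integrable (m.reward t a b) P := by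
  cases b with
  | none => exact integrable_zero _ _ _
  | some b => exact m.integrable_X t a b

theorem integral_reward (m : Market N L P) (t : ℕ) (a : Agent N L)
    (b : Option (Partner a)) : ∫ ω, m.reward t a b ω ∂P = m.pref a b := by
  cases b with
  | none => simp [reward, m.pref_none]
  | some b => exact m.integral_X t a b

theorem eq_sum_indicator_matchAt (m : Market N L P) (t : ℕ) (a : Agent N L)
    (f : Option (Partner a) → Ω → ℝ) (ω : Ω) :
    f (m.matchAt 𝓜 t ω a) ω = ∑ b, {ω | m.matchAt 𝓜 t ω a = b}.indicator (f b) ω := by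
  rw [Finset.sum_eq_single (m.matchAt 𝓜 t ω a)]
  · simp
  · intro b _ hb
    exact Set.indicator_of_notMem (fun h => hb h.symm) _
  · simp

theorem measurableSet_matchAt_eq (m : Market N L P) (h𝓜 : ∀ M', MeasurableSet (𝓜 ⁻¹' {M'}))
    {t : ℕ} (ht : 1 ≤ t) (S : Set (Assignment N L)) :
    MeasurableSet {ω | m.matchAt 𝓜 t ω ∈ S} := by
  obtain ⟨n, rfl⟩ := Nat.exists_eq_add_of_le' ht
  exact m.past_le n _ (m.measurableSet_past_matchAt h𝓜 n S)

theorem integrable_matchAt (m : Market N L P) (h𝓜 : ∀ M', MeasurableSet (𝓜 ⁻¹' {M'}))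
    {t : ℕ} (ht : 1 ≤ t) {a : Agent N L} {f : Option (Partner a) → Ω → ℝ}
    (hf : ∀ b, Integrable (f b) P) : Integrable (fun ω => f (m.matchAt 𝓜 t ω a) ω) P := by
  simp_rw [m.eq_sum_indicator_matchAt t a f]
  exact integrable_finsetSum _ fun b _ =>
    (hf b).indicator (m.measurableSet_matchAt_eq h𝓜 ht {M | M a = b})

/-- The partner at time `t` is chosen independently of the rewards at time `t`, so that the expected
reward is the expected preference. -/
theorem integral_reward_matchAt (m : Market N L P) [IsProbabilityMeasure P]
    (h𝓜 : ∀ M', MeasurableSet (𝓜 ⁻¹' {M'})) {t : ℕ} (ht : 1 ≤ t) (a : Agent N L) :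
    ∫ ω, m.reward t a (m.matchAt 𝓜 t ω a) ω ∂P = ∫ ω, m.pref a (m.matchAt 𝓜 t ω a) ∂P := by
  have h1 := fun ω => m.eq_sum_indicator_matchAt (𝓜 := 𝓜) t a (m.reward t a) ω
  have h2 := fun ω => m.eq_sum_indicator_matchAt (𝓜 := 𝓜) t a (fun b _ => m.pref a b) ω
  have hA : ∀ b, MeasurableSet {ω | m.matchAt 𝓜 t ω a = b} := fun b =>
    m.measurableSet_matchAt_eq h𝓜 ht {M | M a = b}
  simp_rw [h1, h2]
  rw [integral_finsetSum _ fun b _ => (m.integrable_reward t a b).indicator (hA b),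
    integral_finsetSum _ fun b _ => (integrable_const _).indicator (hA b)]
  refine Finset.sum_congr rfl fun b _ => ?_
  cases b with
  | none => simp [reward, m.pref_none, Set.indicator]
  | some b =>
    obtain ⟨n, rfl⟩ := Nat.exists_eq_add_of_le' ht
    set A : Set Ω := {ω | m.matchAt 𝓜 (n + 1) ω a = some b}
    have hAm : MeasurableSet[m.past n] A := m.measurableSet_past_matchAt h𝓜 n {M | M a = some b}
    have hind : IndepFun (A.indicator fun _ => (1 : ℝ)) (m.X (n + 1) a b) P := by
      rw [IndepFun_iff_Indep]
      refine indep_of_indep_of_le_left (m.indep_past n a b) ?_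
      exact Measurable.comap_le
        (Measurable.indicator (m := m.past n) (@measurable_const _ _ _ (m.past n) _) hAm)
    have hmul := hind.integral_fun_mul_eq_mul_integral
      (((measurable_const).indicator (m.past_le n _ hAm)).aestronglyMeasurable)
      (m.X_measurable (n + 1) a b).aestronglyMeasurable
    have e1 : ∀ ω, A.indicator (m.reward (n + 1) a (some b)) ω
        = A.indicator (fun _ => (1 : ℝ)) ω * m.X (n + 1) a b ω := fun ω => by
      by_cases hω : ω ∈ A <;> simp [hω, reward]
    have e2 : ∀ ω, A.indicator (fun _ => m.pref a (some b)) ω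
        = A.indicator (fun _ => (1 : ℝ)) ω * m.pref a (some b) := fun ω => by
      by_cases hω : ω ∈ A <;> simp [hω]
    simp_rw [e1, e2]
    rw [hmul, integral_mul_const, m.integral_X]

theorem integrable_loss (m : Market N L P) [IsProbabilityMeasure P] (hR : R.HasOffset h)
    (h𝓜 : ∀ M', MeasurableSet (𝓜 ⁻¹' {M'})) (M : Assignment N L) (a : Agent N L) {t : ℕ}
    (ht : 1 ≤ t) : Integrable (m.loss R 𝓜 M a t) P := by
  have hobs : ∀ b, Integrable (fun ω => m.reward t a b ω + h a b) P := fun b =>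
    (m.integrable_reward t a b).add (integrable_const _)
  unfold loss
  simp_rw [m.observed_eq hR]
  exact (hobs _).sub (m.integrable_matchAt h𝓜 ht hobs)

/-- The expected loss against `M` is at most the largest possible payoff gap times the probability
of a matching other than `M`. -/
theorem integral_loss_le (m : Market N L P) [IsProbabilityMeasure P] (hR : R.HasOffset h)
    (h𝓜 : ∀ M', MeasurableSet (𝓜 ⁻¹' {M'})) (M : Assignment N L) (a : Agent N L) {t : ℕ}
    (ht : 1 ≤ t) {K : ℝ}
    (hK : ∀ ω, R.payoff m.pref a (M a) - R.payoff m.pref a (m.matchAt 𝓜 t ω a) ≤ K) :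
    ∫ ω, m.loss R 𝓜 M a t ω ∂P ≤ K * P.real {ω | m.matchAt 𝓜 t ω ≠ M} := by
  have hB : MeasurableSet {ω | m.matchAt 𝓜 t ω ≠ M} :=
    m.measurableSet_matchAt_eq h𝓜 ht {M' | M' ≠ M}
  have hoff : Integrable (fun ω => h a (m.matchAt 𝓜 t ω a)) P :=
    m.integrable_matchAt h𝓜 ht (f := fun b _ => h a b) fun _ => integrable_const _
  have hpref : Integrable (fun ω => m.pref a (m.matchAt 𝓜 t ω a)) P :=
    m.integrable_matchAt h𝓜 ht (f := fun b _ => m.pref a b) fun _ => integrable_const _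
  have hrew : Integrable (fun ω => m.reward t a (m.matchAt 𝓜 t ω a) ω) P :=
    m.integrable_matchAt h𝓜 ht (m.integrable_reward t a)
  have hmean : ∫ ω, m.loss R 𝓜 M a t ω ∂P = ∫ ω, (R.payoff m.pref a (M a)
      - R.payoff m.pref a (m.matchAt 𝓜 t ω a)) ∂P := by
    have hrewM : Integrable (fun ω => m.reward t a (M a) ω + h a (M a)) P :=
      (m.integrable_reward t a _).add (integrable_const _)
    have hrew' : Integrable (fun ω => m.reward t a (m.matchAt 𝓜 t ω a) ω
      + h a (m.matchAt 𝓜 t ω a)) P := hrew.add hoff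
    have hpref' : Integrable (fun ω => m.pref a (m.matchAt 𝓜 t ω a)
      + h a (m.matchAt 𝓜 t ω a)) P := hpref.add hoff
    unfold loss
    simp_rw [m.observed_eq hR, hR.payoff_eq]
    rw [integral_sub hrewM hrew',
      integral_add (m.integrable_reward t a _) (integrable_const _), integral_add hrew hoff,
      m.integral_reward_matchAt h𝓜 ht, integral_sub (integrable_const _) hpref',
      integral_add hpref hoff, m.integral_reward]
    simp
  have hint : Integrable (fun ω => R.payoff m.pref a (M a)
      - R.payoff m.pref a (m.matchAt 𝓜 t ω a)) P := by
    simp_rw [hR.payoff_eq]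
    exact (integrable_const _).sub (hpref.add hoff)
  rw [hmean]
  calc _ ≤ ∫ ω, {ω | m.matchAt 𝓜 t ω ≠ M}.indicator (fun _ => K) ω ∂P := by
        refine integral_mono hint ((integrable_const K).indicator hB) fun ω => ?_
        by_cases hω : m.matchAt 𝓜 t ω = M
        · simp [hω]
        · simpa [hω] using hK ω
    _ = _ := by
        rw [integral_indicator_const K hB, smul_eq_mul, mul_comm]

/-! ### The expected number of mismatches -/

/-- Each match with `b` raises the count of samples of `b`, which starts at `T₀ ≥ 1`; hence at most
`l` matches, without rounding up, are made while the count is below `l`. -/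
theorem sum_match_of_count_lt_le (m : Market N L P) (ω : Ω) (a : Agent N L) (b : Partner a)
    {l : ℝ} (hl : 0 ≤ l) (T : ℕ) :
    ∑ t ∈ Finset.Icc 1 T, {ω | m.matchAt 𝓜 t ω a = some b ∧
      ((m.samples 𝓜 ω (t - 1)).count a b : ℝ) < l}.indicator (fun _ => (1 : ℝ)) ω ≤ l := by
  classical
  suffices hs : ∑ t ∈ Finset.Icc 1 T, {ω | m.matchAt 𝓜 t ω a = some b ∧
      ((m.samples 𝓜 ω (t - 1)).count a b : ℝ) < l}.indicator (fun _ => (1 : ℝ)) ω ≤ l ∧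
      ∑ t ∈ Finset.Icc 1 T, {ω | m.matchAt 𝓜 t ω a = some b ∧
      ((m.samples 𝓜 ω (t - 1)).count a b : ℝ) < l}.indicator (fun _ => (1 : ℝ)) ω
        ≤ (m.samples 𝓜 ω T).count a b - 1 from hs.1
  induction T with
  | zero =>
    have : (1 : ℝ) ≤ m.T₀ a b := by exact_mod_cast m.T₀_pos a b
    simp [samples, hl, this]
  | succ n ih =>
    rw [Finset.sum_Icc_succ_top (by omega)]
    have hcount : (m.samples 𝓜 ω (n + 1)).count a b = (m.samples 𝓜 ω n).count a b
        + if m.matchAt 𝓜 (n + 1) ω a = some b then 1 else 0 := rfl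
    by_cases hm : m.matchAt 𝓜 (n + 1) ω a = some b
    · by_cases hc : ((m.samples 𝓜 ω n).count a b : ℝ) < l
      · simp only [Set.indicator, Set.mem_ofPred_eq, hm, hc, hcount, Nat.add_sub_cancel,
          and_self, if_true] at ih ⊢
        push_cast
        exact ⟨by linarith [ih.2], by linarith [ih.2]⟩
      · simp only [Set.indicator, Set.mem_ofPred_eq, hm, hc, hcount, Nat.add_sub_cancel,
          and_false, if_false, if_true] at ih ⊢
        push_cast
        exact ⟨by linarith [ih.1], by linarith [ih.2]⟩
    · simp only [Set.indicator, Set.mem_ofPred_eq, hm, hcount, Nat.add_sub_cancel,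
        false_and, if_false] at ih ⊢
      push_cast
      exact ⟨by linarith [ih.1], by linarith [ih.2]⟩

/-- The upper confidence bound argument: if `a` truly prefers `b'` to its match but not according to
`ν_t`, then some empirical mean is off by its confidence radius, or the match has been sampled so
rarely that its confidence radius exceeds `Δ / 2`. -/
theorem exists_deviation_or_count_lt (m : Market N L P) (hR : R.HasOffset h) {Δ : ℝ} (hΔ : 0 < Δ)
    (hgap : ∀ a (b b' : Partner a), R.payoff m.pref a (some b) < R.payoff m.pref a (some b') →
      Δ ≤ R.payoff m.pref a (some b') - R.payoff m.pref a (some b))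
    {t T : ℕ} (ht : 1 ≤ t) (htT : t ≤ T) {ω : Ω} {a : Agent N L} {b' : Partner a}
    (hμ : R.payoff m.pref a (m.matchAt 𝓜 t ω a) < R.payoff m.pref a (some b'))
    (hν : R.payoff (m.transient 𝓜 t ω) a (some b')
      ≤ R.payoff (m.transient 𝓜 t ω) a (m.matchAt 𝓜 t ω a)) :
    ∃ b : Partner a, ω ∈ m.deviation 𝓜 1 a b t ∨ ω ∈ m.deviation 𝓜 (-1) a b t ∨
      (m.matchAt 𝓜 t ω a = some b ∧ ((m.samples 𝓜 ω (t - 1)).count a b : ℝ) <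
        8 * m.σ ^ 2 * m.α * Real.log T / Δ ^ 2) := by
  have hsome : ∀ b : Partner a, m.transient 𝓜 t ω a (some b)
      = (m.samples 𝓜 ω (t - 1)).total a b / (m.samples 𝓜 ω (t - 1)).count a b
        + m.radius t ((m.samples 𝓜 ω (t - 1)).count a b) := fun b => rfl
  by_contra! hcon
  have hlow : m.pref a (some b') < m.transient 𝓜 t ω a (some b') := by
    have := (hcon b').2.1
    simp only [deviation, Set.mem_ofPred_eq, not_le] at this
    rw [hsome]
    linarith
  cases hb : m.matchAt 𝓜 t ω a with
  | none =>
    rw [hb] at hμ hν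
    have hnone : m.transient 𝓜 t ω a none = 0 := by cases a <;> rfl
    rw [hR.payoff_eq, hR.payoff_eq] at hμ hν
    rw [m.pref_none] at hμ
    rw [hnone] at hν
    linarith
  | some b =>
    rw [hb] at hμ hν
    have hΔ' := hgap a b b' hμ
    have hup := (hcon b).1
    simp only [deviation, Set.mem_ofPred_eq, not_le, one_mul] at hup
    rw [hR.payoff_eq, hR.payoff_eq] at hΔ' hν
    rw [hsome b] at hν
    set c := (m.samples 𝓜 ω (t - 1)).count a b with hc
    have hc0 : (0 : ℝ) < c := by
      exact_mod_cast (m.T₀_pos a b).trans_le (Finset.mem_Icc.1 (m.count_mem_Icc ω (t - 1) a b)).1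
    have hrad : Δ < 2 * m.radius t c := by linarith
    have hlog := Real.log_nonneg (show (1 : ℝ) ≤ t by exact_mod_cast ht)
    have hlogT : Real.log t ≤ Real.log T :=
      Real.log_le_log (by exact_mod_cast ht) (by exact_mod_cast htT)
    have hσ := m.σ_pos
    have hα := m.two_lt_α
    have hsq : m.radius t c ^ 2 * c = 2 * m.σ ^ 2 * m.α * Real.log t := by
      rw [radius, Real.sq_sqrt (by positivity)]
      field_simp
    have hlt : (c : ℝ) < 8 * m.σ ^ 2 * m.α * Real.log T / Δ ^ 2 := by
      rw [lt_div_iff₀ (by positivity)]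
      calc c * Δ ^ 2 < c * (2 * m.radius t c) ^ 2 := by gcongr
        _ = 8 * m.σ ^ 2 * m.α * Real.log t := by linear_combination 4 * hsq
        _ ≤ _ := by gcongr
    exact not_lt_of_ge ((hcon b).2.2 hb) hlt

/-- A matching other than the true stable one has a truly blocking pair, which does not block under
`ν_t`; hence one of its two members misjudges its match. -/
theorem measureReal_matchAt_ne_le (m : Market N L P) [IsProbabilityMeasure P]
    (h𝓜 : ∀ M', MeasurableSet (𝓜 ⁻¹' {M'})) (hR : R.HasOffset h) {Δ : ℝ} (hΔ : 0 < Δ)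
    (hgap : ∀ a (b b' : Partner a), R.payoff m.pref a (some b) < R.payoff m.pref a (some b') →
      Δ ≤ R.payoff m.pref a (some b') - R.payoff m.pref a (some b))
    {M : Assignment N L} (hM : m.trueStable R = {M}) {t T : ℕ} (ht : 1 ≤ t) (htT : t ≤ T)
    (hst : ∀ ω, IsStable (R.payoff (m.transient 𝓜 t ω)) (m.matchAt 𝓜 t ω)) :
    P.real {ω | m.matchAt 𝓜 t ω ≠ M} ≤ ∑ x : Σ a : Agent N L, Partner a,
      (2 * (t : ℝ) ^ (1 - m.α) + P.real {ω | m.matchAt 𝓜 t ω x.1 = some x.2 ∧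
        ((m.samples 𝓜 ω (t - 1)).count x.1 x.2 : ℝ) <
          8 * m.σ ^ 2 * m.α * Real.log T / Δ ^ 2}) := by
  set C : (Σ a : Agent N L, Partner a) → Set Ω := fun x => {ω | m.matchAt 𝓜 t ω x.1 = some x.2 ∧
    ((m.samples 𝓜 ω (t - 1)).count x.1 x.2 : ℝ) < 8 * m.σ ^ 2 * m.α * Real.log T / Δ ^ 2} with hC
  have hcover : {ω | m.matchAt 𝓜 t ω ≠ M} ⊆ ⋃ x ∈ (Finset.univ : Finset (Σ a, Partner a)),
      (m.deviation 𝓜 1 x.1 x.2 t ∪ (m.deviation 𝓜 (-1) x.1 x.2 t ∪ C x)) := by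
    intro ω hω
    have hns : ¬ IsStable (R.payoff m.pref) (m.matchAt 𝓜 t ω) := fun hs =>
      hω (by simpa [hM] using (show m.matchAt 𝓜 t ω ∈ m.trueStable R from hs))
    obtain ⟨u, p, hu, hp⟩ : ∃ (u : Fin N) (p : Fin L),
        R.payoff m.pref (.inl u) (m.matchAt 𝓜 t ω (.inl u))
          < R.payoff m.pref (.inl u) (some p) ∧
        R.payoff m.pref (.inr p) (m.matchAt 𝓜 t ω (.inr p))
          < R.payoff m.pref (.inr p) (some u) := by
      by_contra hno
      exact hns ⟨(hst ω).1, hno⟩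
    have hfind : ∃ (a : Agent N L) (b : Partner a), ω ∈ m.deviation 𝓜 1 a b t ∨
        ω ∈ m.deviation 𝓜 (-1) a b t ∨ ω ∈ C ⟨a, b⟩ := by
      by_cases h1 : R.payoff (m.transient 𝓜 t ω) (.inl u) (m.matchAt 𝓜 t ω (.inl u))
          < R.payoff (m.transient 𝓜 t ω) (.inl u) (some p)
      · have h2 := fun h2 => (hst ω).2 ⟨u, p, h1, h2⟩
        exact ⟨.inr p, m.exists_deviation_or_count_lt hR hΔ hgap ht htT
          (a := .inr p) (b' := u) hp (not_lt.1 h2)⟩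
      · exact ⟨.inl u, m.exists_deviation_or_count_lt hR hΔ hgap ht htT
          (a := .inl u) (b' := p) hu (not_lt.1 h1)⟩
    obtain ⟨a, b, hab⟩ := hfind
    exact Set.mem_iUnion₂.2 ⟨⟨a, b⟩, Finset.mem_univ _, hab⟩
  refine (measureReal_mono hcover (measure_ne_top P _)).trans
    ((measureReal_biUnion_finset_le _ _).trans (Finset.sum_le_sum fun x _ => ?_))
  have h1 := m.measureReal_deviation_le h𝓜 (ε := 1) (by norm_num) x.1 x.2 ht
  have h2 := m.measureReal_deviation_le h𝓜 (ε := -1) (by norm_num) x.1 x.2 ht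
  have h3 := measureReal_union_le (μ := P) (m.deviation 𝓜 1 x.1 x.2 t)
    (m.deviation 𝓜 (-1) x.1 x.2 t ∪ C x)
  have h4 := measureReal_union_le (μ := P) (m.deviation 𝓜 (-1) x.1 x.2 t) (C x)
  linarith

theorem sum_measureReal_match_of_count_lt_le (m : Market N L P) [IsProbabilityMeasure P]
    (h𝓜 : ∀ M', MeasurableSet (𝓜 ⁻¹' {M'})) (a : Agent N L) (b : Partner a)
    {l : ℝ} (hl : 0 ≤ l) (T : ℕ) :
    ∑ t ∈ Finset.Icc 1 T, P.real {ω | m.matchAt 𝓜 t ω a = some b ∧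
      ((m.samples 𝓜 ω (t - 1)).count a b : ℝ) < l} ≤ l := by
  have hm : ∀ t ∈ Finset.Icc 1 T, MeasurableSet {ω | m.matchAt 𝓜 t ω a = some b ∧
      ((m.samples 𝓜 ω (t - 1)).count a b : ℝ) < l} := fun t ht => by
    have h1 := (m.measurable_past_samples h𝓜 (t - 1) a b).1.mono (m.past_le _) le_rfl
    exact (m.measurableSet_matchAt_eq h𝓜 (Finset.mem_Icc.1 ht).1 {M | M a = some b}).inter
      (measurableSet_lt ((measurable_from_nat (f := fun n : ℕ => (n : ℝ))).comp h1)
        measurable_const)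
  have hi := fun t ht => (integrable_const (μ := P) (1 : ℝ)).indicator (hm t ht)
  calc _ = ∑ t ∈ Finset.Icc 1 T, ∫ ω, {ω | m.matchAt 𝓜 t ω a = some b ∧
      ((m.samples 𝓜 ω (t - 1)).count a b : ℝ) < l}.indicator (fun _ => (1 : ℝ)) ω ∂P :=
        Finset.sum_congr rfl fun t ht => by
          rw [integral_indicator_const _ (hm t ht), smul_eq_mul, mul_one]
    _ = ∫ ω, ∑ t ∈ Finset.Icc 1 T, {ω | m.matchAt 𝓜 t ω a = some b ∧
      ((m.samples 𝓜 ω (t - 1)).count a b : ℝ) < l}.indicator (fun _ => (1 : ℝ)) ω ∂P :=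
        (integral_finsetSum _ hi).symm
    _ ≤ ∫ _, l ∂P := integral_mono (integrable_finsetSum _ hi) (integrable_const l)
        fun ω => m.sum_match_of_count_lt_le ω a b hl T
    _ = l := by simp

theorem card_sigma_partner (N L : ℕ) : Fintype.card (Σ a : Agent N L, Partner a) = 2 * (N * L) := by
  rw [Fintype.card_sigma, Fintype.sum_sum_type]
  have h1 : ∀ u : Fin N, Fintype.card (Partner (.inl u : Agent N L)) = L := fun u =>
    Fintype.card_fin L
  have h2 : ∀ p : Fin L, Fintype.card (Partner (.inr p : Agent N L)) = N := fun p =>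
    Fintype.card_fin N
  simp only [h1, h2, Finset.sum_const, Finset.card_univ, Fintype.card_fin, smul_eq_mul]
  ring

/-- The time `t = 1`, at which the deviation bound `t ^ (1 - α)` is trivial, is counted separately:
this yields `1 + 2 / (α - 2) = α / (α - 2)`. -/
theorem sum_measureReal_matchAt_ne_le (m : Market N L P) [IsProbabilityMeasure P]
    (h𝓜 : ∀ M', MeasurableSet (𝓜 ⁻¹' {M'})) (hR : R.HasOffset h) {Δ : ℝ} (hΔ : 0 < Δ)
    (hgap : ∀ a (b b' : Partner a), R.payoff m.pref a (some b) < R.payoff m.pref a (some b') →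
      Δ ≤ R.payoff m.pref a (some b') - R.payoff m.pref a (some b))
    {M : Assignment N L} (hM : m.trueStable R = {M}) {T : ℕ} (hT : 1 ≤ T)
    (hst : ∀ t, 1 ≤ t → ∀ ω, IsStable (R.payoff (m.transient 𝓜 t ω)) (m.matchAt 𝓜 t ω)) :
    ∑ t ∈ Finset.Icc 1 T, P.real {ω | m.matchAt 𝓜 t ω ≠ M} ≤
      2 * (N : ℝ) * L * (8 * m.σ ^ 2 * m.α * Real.log T / Δ ^ 2 + m.α / (m.α - 2)) := by
  set l := 8 * m.σ ^ 2 * m.α * Real.log T / Δ ^ 2 with hl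
  have hα := m.two_lt_α
  have hl0 : 0 ≤ l := by
    have := m.σ_pos
    have := Real.log_nonneg (show (1 : ℝ) ≤ T by exact_mod_cast hT)
    positivity
  set Q : ℕ → (Σ a : Agent N L, Partner a) → ℝ := fun t x =>
    P.real {ω | m.matchAt 𝓜 t ω x.1 = some x.2 ∧
      ((m.samples 𝓜 ω (t - 1)).count x.1 x.2 : ℝ) < l} with hQ
  have hQT : ∀ x, ∑ t ∈ Finset.Icc 2 T, Q t x ≤ l := fun x =>
    (Finset.sum_le_sum_of_subset_of_nonneg (Finset.Icc_subset_Icc_left (by norm_num))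
      fun _ _ _ => measureReal_nonneg).trans
      (m.sum_measureReal_match_of_count_lt_le h𝓜 x.1 x.2 hl0 T)
  have hcard : (Fintype.card (Σ a : Agent N L, Partner a) : ℝ) = 2 * (N * L) := by
    exact_mod_cast card_sigma_partner N L
  have hN : (1 : ℝ) ≤ N := by exact_mod_cast m.one_le_L.trans m.L_le_N
  have hL : (1 : ℝ) ≤ L := by exact_mod_cast m.one_le_L
  have hIcc : Finset.Icc 1 T = insert 1 (Finset.Icc 2 T) := by
    ext t; simp only [Finset.mem_insert, Finset.mem_Icc]; omega
  rw [hIcc, Finset.sum_insert (by simp)]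
  calc _ ≤ 1 + ∑ t ∈ Finset.Icc 2 T, ∑ x : Σ a : Agent N L, Partner a,
        (2 * (t : ℝ) ^ (1 - m.α) + Q t x) := by
        refine add_le_add measureReal_le_one (Finset.sum_le_sum fun t ht => ?_)
        obtain ⟨h2, h3⟩ := Finset.mem_Icc.1 ht
        exact m.measureReal_matchAt_ne_le h𝓜 hR hΔ hgap hM (by omega) h3 (hst t (by omega))
    _ = 1 + ∑ x : Σ a : Agent N L, Partner a,
        (2 * ∑ t ∈ Finset.Icc 2 T, (t : ℝ) ^ (1 - m.α) + ∑ t ∈ Finset.Icc 2 T, Q t x) := by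
        rw [Finset.sum_comm]
        simp_rw [Finset.sum_add_distrib, Finset.mul_sum]
    _ ≤ 1 + ∑ x : Σ a : Agent N L, Partner a, (2 * (1 / (m.α - 2)) + l) := by
        gcongr with x _
        · exact sum_Icc_two_rpow_le hα T hT
        · exact hQT x
    _ = 1 + 2 * (N * L) * (l + 2 / (m.α - 2)) := by
        rw [Finset.sum_const, Finset.card_univ, nsmul_eq_mul, hcard]
        ring
    _ ≤ 2 * N * L * (l + m.α / (m.α - 2)) := by
        have h1 : m.α / (m.α - 2) = 1 + 2 / (m.α - 2) := by
          have : m.α - 2 ≠ 0 := by linarith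
          field_simp
          ring
        rw [h1]
        nlinarith [mul_le_mul hN hL zero_le_one (by linarith)]

end Market

/-! ### Regret and fairness under the prices `2B(L - k)` -/

theorem not_isSuperLog_of_le {r : ℕ → ℝ} {C D : ℝ}
    (hr : ∀ T, 1 ≤ T → r T ≤ C * Real.log T + D) : ¬ IsSuperLog r := by
  intro hs
  have hlog : ∀ᶠ T : ℕ in atTop, |D| + 1 ≤ Real.log T :=
    (Real.tendsto_log_atTop.comp tendsto_natCast_atTop_atTop).eventually_ge_atTop _
  obtain ⟨T, h1, h2, h3⟩ := ((hs (C + 1)).and (hlog.and (eventually_ge_atTop 1))).exists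
  linarith [hr T h3, le_abs_self D]

namespace Market

variable {N L : ℕ} {Ω : Type*} [mΩ : MeasurableSpace Ω] {P : Measure Ω}
  {𝓜 : Pref N L → Assignment N L} {R : Rules N L} {h : Pref N L}

theorem gapMin_le (m : Market N L P) (a : Agent N L) {b c : Option (Partner a)} (hbc : b ≠ c) :
    m.gapMin ≤ |m.pref a b - m.pref a c| :=
  csInf_le ⟨0, by rintro d ⟨a, b, c, -, rfl⟩; exact abs_nonneg _⟩ ⟨a, b, c, hbc, rfl⟩

theorem gapMin_pos (m : Market N L P) : 0 < m.gapMin := by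
  set S : Set ℝ := {d | ∃ (a : Agent N L) (b c : Option (Partner a)), b ≠ c ∧
    d = |m.pref a b - m.pref a c|} with hS
  have hfin : S.Finite := by
    refine (Set.finite_range fun x : Σ a : Agent N L, Option (Partner a) × Option (Partner a) =>
      |m.pref x.1 x.2.1 - m.pref x.1 x.2.2|).subset ?_
    rintro d ⟨a, b, c, -, rfl⟩
    exact ⟨⟨a, b, c⟩, rfl⟩
  have hne : S.Nonempty :=
    ⟨_, .inr ⟨0, m.one_le_L⟩, some (⟨0, m.one_le_L.trans m.L_le_N⟩ : Fin N), none, by simp, rfl⟩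
  obtain ⟨a, b, c, hbc, hd⟩ := hne.csInf_mem hfin
  rw [gapMin, hd, abs_pos, sub_ne_zero]
  exact (m.pref_injective a).ne hbc

theorem le_gapMax (m : Market N L P) (B : ℝ) (M : Assignment N L) (a : Agent N L)
    (b : Option (Partner a)) :
    (if a.isLeft then 2 * B * ((L : ℝ) - 1) else 0) + (m.pref a (M a) - m.pref a b)
      ≤ m.gapMax B M a := by
  unfold gapMax
  gcongr
  exact le_ciSup (f := fun b => m.pref a (M a) - m.pref a b) (Set.finite_range _).bddAbove b

theorem gapMax_nonneg (m : Market N L P) {B : ℝ} (hB : 0 < B) (M : Assignment N L)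
    (a : Agent N L) : 0 ≤ m.gapMax B M a := by
  refine le_trans ?_ (m.le_gapMax B M a (M a))
  have hL : (1 : ℝ) ≤ L := by exact_mod_cast m.one_le_L
  split_ifs
  · have : 0 ≤ (L : ℝ) - 1 := by linarith
    simp only [sub_self, add_zero]
    positivity
  · simp

theorem optimalMatching_eq (m : Market N L P) {M : Assignment N L} (hM : m.trueStable R = {M})
    (a : Agent N L) (t : ℕ) : m.optimalMatching R 𝓜 a t = M := by
  have h := Classical.epsilon_spec (p := fun M' => M' ∈ m.trueStable R ∧
    IsMaxOn (fun M'' : Assignment N L => ∫ ω, m.observed R 𝓜 t a (M'' a) ω ∂P)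
      (m.trueStable R) M') ⟨M, by simp [hM, isMaxOn_iff]⟩
  exact hM.subset h.1

theorem pessimalMatching_eq (m : Market N L P) {M : Assignment N L} (hM : m.trueStable R = {M})
    (a : Agent N L) (t : ℕ) : m.pessimalMatching R 𝓜 a t = M := by
  have h := Classical.epsilon_spec (p := fun M' => M' ∈ m.trueStable R ∧
    IsMinOn (fun M'' : Assignment N L => ∫ ω, m.observed R 𝓜 t a (M'' a) ω ∂P)
      (m.trueStable R) M') ⟨M, by simp [hM, isMinOn_iff]⟩
  exact hM.subset h.1

end Market

/-- The payoff offsets produced by `c₁ = 0`, `c₂ = 2B(1 - L)` and the prices `2B(L - (k p + 1))`: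
`2B (k p)` for a user matched to `p`, and the price for the provider `p`. -/
def staircaseOffset {N L : ℕ} (B : ℝ) (k : Fin L ≃ Fin L) : Pref N L
  | _, none => 0
  | .inl _, some p => 2 * B * (k p : ℕ)
  | .inr p, some _ => 2 * B * ((L : ℝ) - ((k p : ℕ) + 1 : ℝ))

theorem hasOffset_pricingRules {N L : ℕ} (B : ℝ) (k : Fin L ≃ Fin L) :
    (pricingRules (N := N) 0 (2 * B * (1 - (L : ℝ)))
      fun p _ => 2 * B * ((L : ℝ) - ((k p : ℕ) + 1 : ℝ))).HasOffset (staircaseOffset B k) := by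
  rintro ψ (u | p) (_ | b)
  · simp [pricingRules, constantCost, priceTransfer, staircaseOffset]
  · simp only [pricingRules, constantCost, priceTransfer, staircaseOffset]
    ring
  · simp [pricingRules, constantCost, priceTransfer, staircaseOffset]
  · simp [pricingRules, constantCost, priceTransfer, staircaseOffset]

namespace Market

variable {N L : ℕ} {Ω : Type*} [mΩ : MeasurableSpace Ω] {P : Measure Ω}
  {𝓜 : Pref N L → Assignment N L} {R : Rules N L} {B : ℝ} {k : Fin L ≃ Fin L}

/-- Under the true payoffs, all users rank the providers by their position `k`, and consecutive
providers are at least `B` apart: the step of the prices is `2B` and preferences lie in `[0, B]`. -/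
theorem payoff_user_add_le (m : Market N L P) (hR : R.HasOffset (staircaseOffset B k)) (hB : 0 < B)
    (hbd : ∀ (u : Fin N) (b : Option (Fin L)), |m.pref (.inl u) b| ≤ B) (u : Fin N) {p q : Fin L}
    (hpq : k q < k p) : R.payoff m.pref (.inl u) (some q) + B ≤
      R.payoff m.pref (.inl u) (some p) := by
  have h1 := (abs_le.1 (hbd u (some q))).2
  have h2 := m.pref_nonneg (.inl u) (some p)
  have h3 : ((k q : ℕ) : ℝ) + 1 ≤ (k p : ℕ) := by exact_mod_cast hpq
  rw [hR.payoff_eq, hR.payoff_eq]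
  simp only [staircaseOffset]
  nlinarith

theorem exists_trueStable_eq_singleton (m : Market N L P)
    (hR : R.HasOffset (staircaseOffset B k)) (hB : 0 < B)
    (hbd : ∀ (u : Fin N) (b : Option (Fin L)), |m.pref (.inl u) b| ≤ B) :
    ∃ M, m.trueStable R = {M} := by
  refine exists_stableSet_eq_singleton m.L_le_N k (fun u p => ?_) (fun u p q hpq => ?_)
    fun p u u' huu' => ?_
  · have h1 : m.pref (.inl u) none ≠ m.pref (.inl u) (some p) :=
      (m.pref_injective (.inl u)).ne (by simp)
    have h2 := m.pref_nonneg (.inl u) (some p)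
    rw [m.pref_none] at h1
    have h3 := lt_of_le_of_ne h2 h1
    rw [hR.payoff_eq, hR.payoff_eq, m.pref_none]
    simp only [staircaseOffset]
    rw [add_zero]
    positivity
  · linarith [m.payoff_user_add_le hR hB hbd u hpq]
  · simp only [hR.payoff_eq, staircaseOffset, add_left_inj] at huu'
    exact Option.some_inj.1 (m.pref_injective (.inr p) huu')

/-- Payoffs of two partners are never closer than `Δ_min`: for a provider both carry the same
offset, and for a user the steps `2B` of the prices leave a gap of at least `B ≥ Δ_min`. -/
theorem gapMin_le_payoff_sub (m : Market N L P)
    (hR : R.HasOffset (staircaseOffset B k)) (hB : 0 < B)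
    (hbd : ∀ (u : Fin N) (b : Option (Fin L)), |m.pref (.inl u) b| ≤ B)
    (a : Agent N L) (b b' : Partner a)
    (hlt : R.payoff m.pref a (some b) < R.payoff m.pref a (some b')) :
    m.gapMin ≤ R.payoff m.pref a (some b') - R.payoff m.pref a (some b) := by
  rcases a with u | p
  · have hle : m.gapMin ≤ B := by
      refine (m.gapMin_le (.inl u) (b := some b) (c := none) (by simp)).trans ?_
      rw [m.pref_none, sub_zero]
      exact hbd u _
    rcases lt_trichotomy (k b) (k b') with hk | hk | hk
    · linarith [m.payoff_user_add_le hR hB hbd u hk]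
    · rw [k.injective hk] at hlt
      exact absurd hlt (lt_irrefl _)
    · linarith [m.payoff_user_add_le hR hB hbd u hk]
  · simp only [hR.payoff_eq, staircaseOffset, add_lt_add_iff_right, add_sub_add_right_eq_sub]
      at hlt ⊢
    have hne : some b' ≠ some b := fun hbb => by
      rw [hbb] at hlt
      exact lt_irrefl _ hlt
    refine (m.gapMin_le (.inr p) hne).trans_eq (abs_of_pos ?_)
    linarith

/-- Feasibility matters for providers: an unmatched one would also forgo its price. -/
theorem payoff_sub_le_gapMax (m : Market N L P) (hR : R.HasOffset (staircaseOffset B k))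
    (hB : 0 < B) {M M' : Assignment N L} (hM : IsFeasible M) (hM' : IsFeasible M')
    (a : Agent N L) :
    R.payoff m.pref a (M a) - R.payoff m.pref a (M' a) ≤ m.gapMax B M a := by
  refine le_trans ?_ (m.le_gapMax B M a (M' a))
  rw [hR.payoff_eq, hR.payoff_eq]
  rcases a with u | p
  · have h1 : ∀ b : Option (Fin L), 0 ≤ staircaseOffset (N := N) B k (.inl u) b := by
      rintro (_ | p)
      · exact le_rfl
      · simp only [staircaseOffset]
        positivity
    have h2 : ∀ b : Option (Fin L),
        staircaseOffset (N := N) B k (.inl u) b ≤ 2 * B * ((L : ℝ) - 1) := by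
      have hL : (1 : ℝ) ≤ L := by exact_mod_cast m.one_le_L
      rintro (_ | p)
      · have : 0 ≤ (L : ℝ) - 1 := by linarith
        simp only [staircaseOffset]
        positivity
      · have h3 : ((k p : ℕ) : ℝ) + 1 ≤ L := by exact_mod_cast (k p).isLt
        simp only [staircaseOffset]
        gcongr
        linarith
    have h3 := h1 (M' (.inl u))
    have h4 := h2 (M (.inl u))
    simp only [Sum.isLeft_inl, if_true]
    linarith
  · obtain ⟨v, hv⟩ := Option.ne_none_iff_exists'.1 (hM.2 p)
    obtain ⟨v', hv'⟩ := Option.ne_none_iff_exists'.1 (hM'.2 p)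
    rw [hv, hv']
    simp [staircaseOffset]

/-- The optimal regret bound. The expected number of mismatches is at most `2 N L` times the last
factor, so the square on `N` leaves room to spare. -/
theorem optimalRegret_le (m : Market N L P) [IsProbabilityMeasure P]
    (hR : R.HasOffset (staircaseOffset B k)) (hB : 0 < B)
    (hbd : ∀ (u : Fin N) (b : Option (Fin L)), |m.pref (.inl u) b| ≤ B)
    {M : Assignment N L} (hM : m.trueStable R = {M})
    (h𝓜 : ∀ M', MeasurableSet (𝓜 ⁻¹' {M'})) (hGS : m.AppliesGS R 𝓜) (a : Agent N L) {T : ℕ}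
    (hT : 1 ≤ T) :
    m.optimalRegret R 𝓜 a T ≤ 2 * m.gapMax B M a * (N : ℝ) ^ 2 * L *
      (8 * m.σ ^ 2 * m.α * Real.log T / m.gapMin ^ 2 + m.α / (m.α - 2)) := by
  have hst : ∀ t, 1 ≤ t → ∀ ω, IsStable (R.payoff (m.transient 𝓜 t ω)) (m.matchAt 𝓜 t ω) :=
    fun t ht ω => (hGS t ht ω).isStable
  have hMf : IsFeasible M := by
    have : M ∈ m.trueStable R := by rw [hM]; rfl
    exact this.1
  have hK := m.gapMax_nonneg hB M a
  have hN : (1 : ℝ) ≤ N := by exact_mod_cast m.one_le_L.trans m.L_le_N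
  have hpos : 0 ≤ 8 * m.σ ^ 2 * m.α * Real.log T / m.gapMin ^ 2 + m.α / (m.α - 2) := by
    have := m.σ_pos
    have := m.two_lt_α
    have := m.gapMin_pos
    have : 0 < m.α - 2 := by linarith
    have := Real.log_nonneg (show (1 : ℝ) ≤ T by exact_mod_cast hT)
    positivity
  unfold optimalRegret
  simp_rw [m.optimalMatching_eq hM]
  rw [integral_finsetSum _ fun t ht => m.integrable_loss hR h𝓜 M a (Finset.mem_Icc.1 ht).1]
  calc _ ≤ ∑ t ∈ Finset.Icc 1 T, m.gapMax B M a * P.real {ω | m.matchAt 𝓜 t ω ≠ M} :=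
        Finset.sum_le_sum fun t ht => by
          have ht1 := (Finset.mem_Icc.1 ht).1
          exact m.integral_loss_le hR h𝓜 M a ht1 fun ω =>
            m.payoff_sub_le_gapMax hR hB hMf (hst t ht1 ω).1 a
    _ = m.gapMax B M a * ∑ t ∈ Finset.Icc 1 T, P.real {ω | m.matchAt 𝓜 t ω ≠ M} :=
        (Finset.mul_sum _ _ _).symm
    _ ≤ m.gapMax B M a * (2 * (N : ℝ) * L *
        (8 * m.σ ^ 2 * m.α * Real.log T / m.gapMin ^ 2 + m.α / (m.α - 2))) := by
        gcongr
        exact m.sum_measureReal_matchAt_ne_le h𝓜 hR m.gapMin_pos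
          (m.gapMin_le_payoff_sub hR hB hbd) hM hT hst
    _ ≤ m.gapMax B M a * (2 * (N : ℝ) ^ 2 * L *
        (8 * m.σ ^ 2 * m.α * Real.log T / m.gapMin ^ 2 + m.α / (m.α - 2))) := by
        gcongr
        nlinarith
    _ = _ := by ring

end Market

end MatchingBandits

theorem theorem2 {N L : ℕ} {Ω : Type*} [MeasurableSpace Ω] (P : Measure Ω)
    [IsProbabilityMeasure P] (m : Market N L P) :
    -- incentive compatibility, for all constant costs and all pricing rules
    (∀ (c₁ c₂ : ℝ) (g : Fin L → Pref N L → ℝ) (𝓜 : Pref N L → Assignment N L),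
      m.AppliesGS (pricingRules c₁ c₂ g) 𝓜 →
        m.IsIncentiveCompatible (pricingRules c₁ c₂ g) 𝓜) ∧
    -- low regret and fairness, for suitable costs and prices
    (∀ B : ℝ, 0 < B → (∀ (u : Fin N) (b : Option (Fin L)), |m.pref (.inl u) b| ≤ B) →
      -- any ordering of the providers; `k p + 1` is the position of the provider `p`
      ∀ k : Fin L ≃ Fin L,
      ∃ (c₁ c₂ : ℝ) (g : Fin L → Pref N L → ℝ),
        c₁ = 0 ∧ c₂ = 2 * B * (1 - (L : ℝ)) ∧
        (∀ p ψ, g p ψ = 2 * B * ((L : ℝ) - ((k p : ℕ) + 1 : ℝ))) ∧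
        ∃ M : Assignment N L, m.trueStable (pricingRules c₁ c₂ g) = {M} ∧
          ∀ 𝓜 : Pref N L → Assignment N L, (∀ M', MeasurableSet (𝓜 ⁻¹' {M'})) →
            m.AppliesGS (pricingRules c₁ c₂ g) 𝓜 →
            (∀ (a : Agent N L) (t : ℕ), 1 ≤ t → ∀ M' : Assignment N L,
              Integrable (m.loss (pricingRules c₁ c₂ g) 𝓜 M' a t) P) ∧
            (∀ (a : Agent N L) (T : ℕ), 1 ≤ T →
              m.pessimalRegret (pricingRules c₁ c₂ g) 𝓜 a T
                = m.optimalRegret (pricingRules c₁ c₂ g) 𝓜 a T ∧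
              m.optimalRegret (pricingRules c₁ c₂ g) 𝓜 a T
                ≤ 2 * m.gapMax B M a * (N : ℝ) ^ 2 * L *
                  (8 * m.σ ^ 2 * m.α * Real.log T / m.gapMin ^ 2 + m.α / (m.α - 2))) ∧
            m.IsFair (pricingRules c₁ c₂ g) 𝓜) := by
  refine ⟨fun c₁ c₂ g 𝓜 hGS t ht ω => (hGS t ht ω).isStable, fun B hB hbd k => ?_⟩
  refine ⟨0, _, fun p _ => 2 * B * ((L : ℝ) - ((k p : ℕ) + 1 : ℝ)), rfl, rfl, fun _ _ => rfl, ?_⟩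
  have hR := hasOffset_pricingRules (N := N) B k
  obtain ⟨M, hM⟩ := m.exists_trueStable_eq_singleton hR hB hbd
  refine ⟨M, hM, fun 𝓜 h𝓜 hGS => ?_⟩
  have hreg := fun (a : Agent N L) (T : ℕ) (hT : 1 ≤ T) =>
    m.optimalRegret_le hR hB hbd hM h𝓜 hGS a hT
  refine ⟨fun a t ht M' => m.integrable_loss hR h𝓜 M' a ht, fun a T hT => ⟨?_, hreg a T hT⟩, ?_⟩
  · unfold Market.pessimalRegret Market.optimalRegret
    simp_rw [m.pessimalMatching_eq hM, m.optimalMatching_eq hM]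
  · rintro ⟨A, -, -, a, -, a', -, -, hsuper⟩
    refine not_isSuperLog_of_le (C := 2 * m.gapMax B M a' * (N : ℝ) ^ 2 * L *
      (8 * m.σ ^ 2 * m.α / m.gapMin ^ 2)) (D := 2 * m.gapMax B M a' * (N : ℝ) ^ 2 * L *
      (m.α / (m.α - 2))) (fun T hT => (hreg a' T hT).trans_eq ?_) hsuper
    ring
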